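/- A twofold triple system TTS$(v)$ consists of a set $V$ of $v$ points together with a finite collection $\mathcal{B}$ (repetitions allowed) of $3$-element subsets of $V$, called blocks, such that every $2$-element subset of $V$ is contained in exactly two blocks, counted with multiplicity. Its $2$-block-intersection graph ($2$-BIG) has the blocks as its vertices (a block that occurs $m$ times gives $m$ vertices), and two vertices $B_1, B_2$ are adjacent if and only if $|B_1 \cap B_2| = 2$. A Hamilton path of a graph is a path that visits every vertex exactly once; a Hamilton path in the $2$-BIG of a TTS$(v)$ is also called a $2$-intersecting Gray code. **Theorem.** Let $v \ge 3$ be an integer. There exists a TTS$(v)$ whose $2$-BIG has a Hamilton path if and only if $v \equiv 0$ or $1 \pmod 3$ and $v \neq 3$. -/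

import Mathlib

/-- A balanced incomplete block design on the point set `V` with block size `k` and index `l`.
Blocks form a multiset, so repeated blocks are allowed. -/
structure BIBD (V : Type*) [DecidableEq V] (k l : ℕ) where
  /-- the blocks, with multiplicity -/
  blocks : Multiset (Finset V)
  card_block : ∀ B ∈ blocks, B.card = k
  card_pair : ∀ x y : V, x ≠ y → (blocks.filter (fun B => x ∈ B ∧ y ∈ B)).card = l

/-- A twofold triple system on the point set `V`; it is a TTS(v) when `V` has `v` points. -/
abbrev TwofoldTripleSystem (V : Type*) [DecidableEq V] := BIBD V 3 2

/-- The `i`-block-intersection graph. Its vertices are the blocks, where a block of multiplicity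
`m` gives `m` different vertices; two different vertices are adjacent iff the blocks meet in
exactly `i` points. -/
def BIBD.blockIntersectionGraph {V : Type*} [DecidableEq V] {k l : ℕ} (D : BIBD V k l) (i : ℕ) :
    SimpleGraph D.blocks.ToType where
  Adj B C := B ≠ C ∧ (B.1 ∩ C.1).card = i
  symm := ⟨fun B C h => ⟨h.1.symm, by rw [Finset.inter_comm]; exact h.2⟩⟩
  loopless := ⟨fun _ h => h.1 rfl⟩

open Classical in
/-- A graph has a Hamilton path: a walk that visits every vertex exactly once. -/
def HasHamiltonPath {W : Type*} (G : SimpleGraph W) : Prop :=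
  ∃ (a b : W) (p : G.Walk a b), p.IsHamiltonian

/-! ### Counting pairs in blocks -/

/-! Necessity is a count. A block holds six ordered pairs and each ordered pair lies in two blocks,
so a TTS(v) has v(v-1)/3 blocks. For v = 3 these are two copies of the whole set, which meet in
three points.

For sufficiency, base triples are developed modulo N = 6t ± 1, with outer points added. A zigzag
through t consecutive residues has steps t-1, ..., 1. Joining its edges to an apex gives triples in
which neighbours share the apex and a vertex, so they form a chain; each step occurs once and each
spoke twice, except the two end spokes. Two such fans and one or two further triples give every
difference its two occurrences, apart from the difference t modulo 6t-1. If the last base triple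
shares two points with the translate of the first by a unit g, the translates by 0, g, 2g, ...
concatenate to a chain of all translates (`chainFromTo_lift`).

Modulo 6t+1 this settles v = 6t+1. Modulo 6t-1 the difference t occurs only once, and an outer point
X with the closed rail of all {X, w, w+z}, z = ±t, supplies the other: v = 6t. To add three points,
the translates of one base triple ρ, whose differences are units, are traded for three rails. One
translate of ρ is kept, its edges are cut out of the rails, and the gaps are bridged by blocks with
two outer points (`ring`). This gives 6t+4, and together with a closed rail 6t+3.

Only coverage and adjacency need checking: by `exists_grayCode_of_list` the number of blocks forces
everything else. The orders 4, 6, 7, 9, 10 have explicit lists. -/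

lemma sum_offDiag_card_filter {V : Type*} [Fintype V] [DecidableEq V] (S : Multiset (Finset V)) :
    ∑ p ∈ (Finset.univ : Finset V).offDiag, (S.filter (fun B => p.1 ∈ B ∧ p.2 ∈ B)).card =
      (S.map (fun B => B.offDiag.card)).sum := by
  induction S using Multiset.induction with
  | empty => simp
  | cons B S ih =>
    have h : ∀ p : V × V, ((B ::ₘ S).filter (fun B => p.1 ∈ B ∧ p.2 ∈ B)).card =
        (S.filter (fun B => p.1 ∈ B ∧ p.2 ∈ B)).card + if p.1 ∈ B ∧ p.2 ∈ B then 1 else 0 := by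
      intro p
      rw [← Multiset.countP_eq_card_filter, ← Multiset.countP_eq_card_filter, Multiset.countP_cons]
    simp_rw [h]
    rw [Finset.sum_add_distrib, ih, Multiset.map_cons, Multiset.sum_cons, add_comm,
      Finset.sum_boole, Nat.cast_id]
    congr 2
    ext ⟨x, y⟩
    simp only [Finset.mem_filter, Finset.mem_offDiag, Finset.mem_univ, true_and]
    tauto

lemma three_mul_card_blocks {V : Type*} [Fintype V] [DecidableEq V] (T : TwofoldTripleSystem V) :
    3 * T.blocks.card = Fintype.card V * (Fintype.card V - 1) := by
  have h := sum_offDiag_card_filter T.blocks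
  have h1 : (T.blocks.map (fun B => B.offDiag.card)) = T.blocks.map (fun _ => 6) := by
    refine Multiset.map_congr rfl fun B hB => ?_
    rw [Finset.offDiag_card, T.card_block B hB]
  rw [h1, Multiset.map_const', Multiset.sum_replicate,
    Finset.sum_congr rfl (g := fun _ => 2) (fun p hp => T.card_pair _ _ (by simpa using hp)),
    Finset.sum_const, Finset.offDiag_card, smul_eq_mul, smul_eq_mul, Finset.card_univ] at h
  rw [Nat.mul_sub, mul_one]
  omega

lemma modEq_of_twofoldTripleSystem {V : Type*} [Fintype V] [DecidableEq V]
    (T : TwofoldTripleSystem V) (h0 : 1 ≤ Fintype.card V) :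
    Fintype.card V ≡ 0 [MOD 3] ∨ Fintype.card V ≡ 1 [MOD 3] := by
  have h := three_mul_card_blocks T
  have h3 : 3 ∣ Fintype.card V * (Fintype.card V - 1) := ⟨_, h.symm⟩
  rcases (Nat.prime_three.dvd_mul).1 h3 with h | h
  · exact Or.inl ((Nat.modEq_zero_iff_dvd).2 h)
  · exact Or.inr ((Nat.modEq_iff_dvd' h0).2 h).symm

lemma card_ne_three_of_hasHamiltonPath {V : Type*} [Fintype V] [DecidableEq V]
    (T : TwofoldTripleSystem V) (h : HasHamiltonPath (T.blockIntersectionGraph 2)) :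
    Fintype.card V ≠ 3 := by
  classical
  intro h3
  have hc := three_mul_card_blocks T
  rw [h3] at hc
  have huniv : ∀ B : T.blocks.ToType, B.1 = Finset.univ := fun B =>
    Finset.eq_univ_of_card _ (by
      rw [T.card_block B.1 (Multiset.count_pos.1 (lt_of_le_of_lt (Nat.zero_le _) B.2.2)), h3])
  obtain ⟨a, b, p, hp⟩ := h
  -- There are two blocks, so the path has an edge; but all blocks equal the whole set and meet in
  -- three points.
  cases p with
  | nil =>
    have := hp.length_support
    rw [Multiset.card_coe] at this
    simp at this
    omega
  | cons hab q =>
    have := hab.2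
    rw [huniv, huniv, Finset.inter_self, Finset.card_univ] at this
    omega

/-! ### From a list of blocks to a Gray code -/

/-- Two sets of at most three points that are written with two common points. -/
def Share {V : Type*} [DecidableEq V] (B C : Finset V) : Prop :=
  ∃ a b c d : V, B = {a, b, c} ∧ C = {a, b, d}

lemma two_le_countP_of_mem {α : Type*} {L : List α} {p : α → Prop} [DecidablePred p]
    {a b : α} (ha : a ∈ L) (hb : b ∈ L) (hab : a ≠ b) (pa : p a) (pb : p b) :
    2 ≤ ((L : Multiset α).filter p).card := by
  classical
  have h : ({a, b} : Multiset α) ≤ (L : Multiset α).filter p := by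
    rw [Multiset.le_iff_subset (by simp [hab])]
    intro x hx
    simp only [Multiset.insert_eq_cons, Multiset.mem_cons, Multiset.mem_singleton] at hx
    rcases hx with rfl | rfl <;> simp [*]
  simpa using Multiset.card_le_card h

lemma exists_hamiltonPath_of_nodup {V : Type*} [DecidableEq V] (T : TwofoldTripleSystem V)
    {L : List (Finset V)} (hL : T.blocks = L) (hne : L ≠ []) (hnd : L.Nodup)
    (hch : L.IsChain fun B C => (B ∩ C).card = 2) :
    HasHamiltonPath (T.blockIntersectionGraph 2) := by
  classical
  have hpos : ∀ B ∈ L, 0 < T.blocks.count B := fun B hB => by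
    rw [hL, Multiset.count_pos]; exact hB
  -- Without repetitions every multiplicity is 1, so copy number 0 of each block exhausts the
  -- vertices.
  let W : List T.blocks.ToType := L.attach.map fun B => ⟨B.1, ⟨0, hpos B.1 B.2⟩⟩
  have hWL : W.map (fun B => B.1) = L :=
    List.map_map.trans (List.attach_map_subtype_val L)
  have hWnd : W.Nodup := List.Nodup.of_map (fun B => B.1) (by rw [hWL]; exact hnd)
  have hWch : W.IsChain (T.blockIntersectionGraph 2).Adj := by
    have h1 : W.IsChain fun B C => (B.1 ∩ C.1).card = 2 := by
      rw [← hWL, List.isChain_map] at hch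
      exact hch
    have h2 := hWnd.isChain
    have := List.isChain_iff_getElem.1 h1
    have := List.isChain_iff_getElem.1 h2
    rw [List.isChain_iff_getElem]
    exact fun i hi => ⟨this i hi, by solve_by_elim⟩
  have hWne : W ≠ [] := by
    intro h; rw [h] at hWL; exact hne hWL.symm
  refine ⟨_, _, SimpleGraph.Walk.ofSupport W hWne hWch, ?_⟩
  refine SimpleGraph.Walk.IsPath.isHamiltonian_of_mem ?_ ?_
  · rw [SimpleGraph.Walk.isPath_def, SimpleGraph.Walk.support_ofSupport]
    exact hWnd
  · rintro ⟨B, i, hi⟩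
    rw [SimpleGraph.Walk.support_ofSupport]
    have hB : B ∈ L := by
      have : 0 < T.blocks.count B := by omega
      rw [hL, Multiset.count_pos] at this
      exact this
    have hle : T.blocks.count B ≤ 1 := by
      rw [hL, Multiset.coe_count]; exact List.nodup_iff_count_le_one.1 hnd B
    have : i = 0 := by omega
    subst this
    exact List.mem_map.2 ⟨⟨B, hB⟩, List.mem_attach _ _, rfl⟩

/-- A list of at most `v (v - 1) / 3` sets of at most three points in which any two points lie in
two different members, and in which neighbours share two points, is a Gray code of a twofold triple
system: the counts force equality everywhere. -/
theorem exists_grayCode_of_list {V : Type*} [Fintype V] [DecidableEq V] (L : List (Finset V))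
    (hne : L ≠ []) (hcard : ∀ B ∈ L, B.card ≤ 3)
    (hlen : 3 * L.length ≤ Fintype.card V * (Fintype.card V - 1))
    (hcov : ∀ x y : V, x ≠ y →
      ∃ B ∈ L, ∃ C ∈ L, B ≠ C ∧ (x ∈ B ∧ y ∈ B) ∧ (x ∈ C ∧ y ∈ C))
    (hch : L.IsChain Share) :
    ∃ T : TwofoldTripleSystem V, HasHamiltonPath (T.blockIntersectionGraph 2) := by
  have hsum := sum_offDiag_card_filter (L : Multiset (Finset V))
  have hge : ∀ p ∈ (Finset.univ : Finset V).offDiag,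
      2 ≤ ((L : Multiset (Finset V)).filter (fun B => p.1 ∈ B ∧ p.2 ∈ B)).card := by
    intro p hp
    obtain ⟨B, hB, C, hC, hBC, h1, h2⟩ := hcov p.1 p.2 (by simpa using hp)
    exact two_le_countP_of_mem hB hC hBC h1 h2
  have h6 : ∀ B ∈ L, B.offDiag.card ≤ 6 := by
    intro B hB
    have h := hcard B hB
    rw [Finset.offDiag_card]
    interval_cases B.card <;> simp
  have hsumL : ((L : Multiset (Finset V)).map (fun B => B.offDiag.card)).sum =
      (L.map (fun B => B.offDiag.card)).sum := by simp
  have hle : (L.map (fun B => B.offDiag.card)).sum ≤ L.length * 6 := by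
    have := List.sum_le_card_nsmul (L.map (fun B => B.offDiag.card)) 6 (by
      intro x hx
      obtain ⟨B, hB, rfl⟩ := List.mem_map.1 hx
      exact h6 B hB)
    simpa using this
  have h2 : ∑ p ∈ (Finset.univ : Finset V).offDiag, 2 =
      2 * (Fintype.card V * (Fintype.card V - 1)) := by
    rw [Finset.sum_const, Finset.offDiag_card, smul_eq_mul, Finset.card_univ, Nat.mul_sub, mul_one,
      mul_comm]
  have hge' := Finset.sum_le_sum hge
  -- The incidence sum is at least 2v(v-1) by coverage and at most six times the length, hence at
  -- most 2v(v-1): equality holds termwise.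
  have hpair : ∀ p ∈ (Finset.univ : Finset V).offDiag,
      2 = ((L : Multiset (Finset V)).filter (fun B => p.1 ∈ B ∧ p.2 ∈ B)).card :=
    (Finset.sum_eq_sum_iff_of_le hge).1 (by omega)
  have hall : ∀ B ∈ L, B.card = 3 := by
    intro B hB
    by_contra hlt
    have hB3 := hcard B hB
    have hBlt : B.offDiag.card < 6 := by
      rw [Finset.offDiag_card]
      interval_cases B.card <;> simp_all
    have : (L.map (fun B => B.offDiag.card)).sum < (L.map (fun _ => 6)).sum :=
      List.sum_lt_sum _ _ h6 ⟨B, hB, hBlt⟩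
    rw [List.map_const', List.sum_replicate, smul_eq_mul] at this
    omega
  have hnd : L.Nodup := by
    rw [List.nodup_iff_count_le_one]
    intro B
    by_contra hlt
    have hB : B ∈ L := List.count_pos_iff.1 (by omega)
    obtain ⟨x, hx, y, hy, hxy⟩ := Finset.one_lt_card.1 (by rw [hall B hB]; omega : 1 < B.card)
    obtain ⟨C, hC, hCB, hxC, hyC⟩ : ∃ C ∈ L, C ≠ B ∧ x ∈ C ∧ y ∈ C := by
      obtain ⟨C, hC, D, hD, hCD, h1, h2⟩ := hcov x y hxy
      by_cases hCB : C = B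
      · exact ⟨D, hD, fun h => hCD (hCB.trans h.symm), h2⟩
      · exact ⟨C, hC, hCB, h1⟩
    -- A repeated block B, with another block C through x and y, would put three blocks on that
    -- pair.
    have hle3 : ({C, B, B} : Multiset (Finset V)) ≤
        (L : Multiset (Finset V)).filter (fun B => x ∈ B ∧ y ∈ B) := by
      rw [Multiset.le_iff_count]
      intro D
      by_cases hD : D = B
      · subst hD
        rw [Multiset.count_filter_of_pos ⟨hx, hy⟩, Multiset.coe_count]
        simp [hCB.symm]
        omega
      · by_cases hDC : D = C
        · subst hDC
          rw [Multiset.count_filter_of_pos ⟨hxC, hyC⟩, Multiset.coe_count]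
          simp [hD]
          exact hC
        · simp [hD, hDC]
    have h3 := Multiset.card_le_card hle3
    have := hpair (x, y) (by simpa using hxy)
    simp at h3
    simp at this
    omega
  refine ⟨⟨L, hall, fun x y hxy => (hpair (x, y) (by simpa using hxy)).symm⟩,
    exists_hamiltonPath_of_nodup _ rfl hne hnd ?_⟩
  rw [List.isChain_iff_getElem] at hch ⊢
  intro i hi
  have hS := hch i hi
  have hB := hall _ (List.getElem_mem (Nat.lt_of_succ_lt hi))
  have hC := hall _ (List.getElem_mem hi)
  have hBC : L[i] ≠ L[i + 1] := fun h => by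
    have := (hnd.getElem_inj_iff).1 h
    omega
  obtain ⟨a, b, c, d, h1, h2⟩ := hS
  rw [h1] at hB hBC ⊢
  rw [h2] at hC hBC ⊢
  have hab : a ≠ b := by
    rintro rfl
    have := Finset.card_le_two (a := a) (b := c)
    simp at hB
    omega
  have hsub : ({a, b} : Finset V) ⊆ {a, b, c} ∩ {a, b, d} := by
    intro x; simp; tauto
  have hge2 := Finset.card_le_card hsub
  rw [Finset.card_pair hab] at hge2
  have hle3 : (({a, b, c} : Finset V) ∩ {a, b, d}).card ≤ 3 :=
    hB ▸ Finset.card_le_card Finset.inter_subset_left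
  -- Three common points would make the two neighbours equal, against `hnd`.
  rcases Nat.lt_or_ge (({a, b, c} : Finset V) ∩ {a, b, d}).card 3 with h | h
  · omega
  · exact absurd ((Finset.eq_of_subset_of_card_le Finset.inter_subset_left (by omega)).symm.trans
      (Finset.eq_of_subset_of_card_le Finset.inter_subset_right (by omega))) hBC

/-! ### Chains with given ends -/

/-- `l` is an `R`-chain that starts at `a` and ends at `b`. -/
def ChainFromTo {α : Type*} (R : α → α → Prop) (l : List α) (a b : α) : Prop :=
  l.IsChain R ∧ l.head? = some a ∧ l.getLast? = some b

namespace ChainFromTo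

variable {α β : Type*} {R : α → α → Prop}

lemma singleton (a : α) : ChainFromTo R [a] a a := ⟨List.isChain_singleton a, rfl, rfl⟩

lemma append {l l' : List α} {a b a' b' : α} (h : ChainFromTo R l a b)
    (h' : ChainFromTo R l' a' b') (hR : R b a') : ChainFromTo R (l ++ l') a b' := by
  obtain ⟨h1, h2, h3⟩ := h
  obtain ⟨h1', h2', h3'⟩ := h'
  refine ⟨List.isChain_append.2 ⟨h1, h1', ?_⟩, ?_, ?_⟩
  · intro x hx y hy
    rw [h3] at hx
    rw [h2'] at hy
    cases hx
    cases hy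
    exact hR
  · rw [List.head?_append, h2]; rfl
  · rw [List.getLast?_append, h3']; rfl

lemma cons {l : List α} {a b c : α} (h : ChainFromTo R l a b) (hR : R c a) :
    ChainFromTo R (c :: l) c b :=
  (singleton c).append h hR

lemma map {S : β → β → Prop} {l : List α} {a b : α} (h : ChainFromTo R l a b) (f : α → β)
    (hf : ∀ x y, R x y → S (f x) (f y)) : ChainFromTo S (l.map f) (f a) (f b) := by
  obtain ⟨h1, h2, h3⟩ := h
  exact ⟨List.isChain_map_of_isChain f hf h1, by simp [h2], by simp [h3]⟩

lemma flatMap_range {F : ℕ → List α} {s e : ℕ → α} {k : ℕ}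
    (hF : ∀ i ≤ k, ChainFromTo R (F i) (s i) (e i)) (hR : ∀ i < k, R (e i) (s (i + 1))) :
    ChainFromTo R ((List.range (k + 1)).flatMap F) (s 0) (e k) := by
  induction k with
  | zero => simpa using hF 0 le_rfl
  | succ k ih =>
    rw [List.range_succ, List.flatMap_append]
    refine (ih (fun i hi => hF i (by omega)) (fun i hi => hR i (by omega))).append ?_
      (hR k (by omega))
    simpa using hF (k + 1) le_rfl

lemma map_range {f : ℕ → α} {k : ℕ} (hR : ∀ i < k, R (f i) (f (i + 1))) :
    ChainFromTo R ((List.range (k + 1)).map f) (f 0) (f k) := by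
  rw [← List.flatMap_singleton' ((List.range (k + 1)).map f), List.flatMap_map]
  exact flatMap_range (fun i _ => singleton (f i)) hR

end ChainFromTo

/-! ### Translates of triples of integers modulo `N` -/

/-- The translate by `u` of the reduction modulo `N` of the triple `τ`. The points outside `ZMod N`
are labelled by `K`. -/
def blk (N : ℕ) (K : Type) [DecidableEq K] (u : ZMod N) (τ : Fin 3 → ℤ) : Finset (ZMod N ⊕ K) :=
  Finset.univ.image fun i => Sum.inl (u + τ i)

/-- Two triples agree modulo `N` in two places. -/
def ShareMod (N : ℕ) (τ σ : Fin 3 → ℤ) : Prop :=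
  ∃ i j k l : Fin 3, i ≠ j ∧ k ≠ l ∧ (N : ℤ) ∣ σ k - τ i ∧ (N : ℤ) ∣ σ l - τ j

lemma ShareMod.of_eq {N : ℕ} {τ σ : Fin 3 → ℤ} (i j k l : Fin 3) (hij : i ≠ j) (hkl : k ≠ l)
    (h1 : σ k = τ i) (h2 : σ l = τ j) : ShareMod N τ σ :=
  ⟨i, j, k, l, hij, hkl, ⟨0, by rw [h1]; ring⟩, ⟨0, by rw [h2]; ring⟩⟩

lemma Finset.image_fin_three {α : Type*} [DecidableEq α] (f : Fin 3 → α) {i j k : Fin 3}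
    (hij : i ≠ j) (hik : i ≠ k) (hjk : j ≠ k) : Finset.univ.image f = {f i, f j, f k} := by
  have h : (Finset.univ : Finset (Fin 3)) = {i, j, k} := by
    revert i j k
    decide
  rw [h, Finset.image_insert, Finset.image_insert, Finset.image_singleton]

lemma exists_third (i j : Fin 3) (hij : i ≠ j) : ∃ k, i ≠ k ∧ j ≠ k := by
  revert i j
  decide

section Translates

variable {N : ℕ} {K : Type} [DecidableEq K]

lemma card_blk_le (u : ZMod N) (τ : Fin 3 → ℤ) : (blk N K u τ).card ≤ 3 :=
  Finset.card_image_le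

lemma intCast_eq_of_dvd {a b : ℤ} (h : (N : ℤ) ∣ b - a) : (a : ZMod N) = b :=
  (ZMod.intCast_eq_intCast_iff_dvd_sub a b N).2 h

lemma blk_eq (u : ZMod N) (τ : Fin 3 → ℤ) {i j k : Fin 3}
    (hij : i ≠ j) (hik : i ≠ k) (hjk : j ≠ k) :
    blk N K u τ = {Sum.inl (u + τ i), Sum.inl (u + τ j), Sum.inl (u + τ k)} :=
  Finset.image_fin_three _ hij hik hjk

lemma mem_blk (u : ZMod N) (τ : Fin 3 → ℤ) (i : Fin 3) : Sum.inl (u + τ i) ∈ blk N K u τ :=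
  Finset.mem_image_of_mem _ (Finset.mem_univ i)

lemma inr_notMem_blk (u : ZMod N) (τ : Fin 3 → ℤ) (k : K) : Sum.inr k ∉ blk N K u τ := by
  simp [blk]

lemma share_blk {τ σ : Fin 3 → ℤ} (h : ShareMod N τ σ) (u : ZMod N) :
    Share (blk N K u τ) (blk N K u σ) := by
  obtain ⟨i, j, k, l, hij, hkl, h1, h2⟩ := h
  obtain ⟨m, him, hjm⟩ := exists_third i j hij
  obtain ⟨n, hkn, hln⟩ := exists_third k l hkl
  refine ⟨_, _, _, Sum.inl (u + σ n), blk_eq u τ hij him hjm, ?_⟩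
  rw [blk_eq u σ hkl hkn hln, intCast_eq_of_dvd h1, intCast_eq_of_dvd h2]

lemma share_blk_add {τ σ : Fin 3 → ℤ} {g : ℤ} (h : ShareMod N τ (fun i => g + σ i))
    (u : ZMod N) : Share (blk N K u τ) (blk N K (u + g) σ) := by
  have : blk N K (u + g) σ = blk N K u (fun i => g + σ i) := by
    simp [blk, add_assoc]
  rw [this]
  exact share_blk h u

/-- The translates by `a * g, (a + 1) * g, …, (a + m - 1) * g` of a list of triples. -/
def lift (N : ℕ) (K : Type) [DecidableEq K] (bs : List (Fin 3 → ℤ)) (g : ℤ) (a m : ℕ) :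
    List (Finset (ZMod N ⊕ K)) :=
  (List.range m).flatMap fun j => bs.map (blk N K (((a + j : ℕ) : ZMod N) * g))

lemma length_lift (bs : List (Fin 3 → ℤ)) (g : ℤ) (a m : ℕ) :
    (lift N K bs g a m).length = m * bs.length := by
  simp [lift, List.length_flatMap]

lemma card_le_of_mem_lift {bs : List (Fin 3 → ℤ)} {g : ℤ} {a m : ℕ}
    {B : Finset (ZMod N ⊕ K)} (hB : B ∈ lift N K bs g a m) : B.card ≤ 3 := by
  simp only [lift, List.mem_flatMap, List.mem_map] at hB
  obtain ⟨j, -, τ, -, rfl⟩ := hB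
  exact card_blk_le _ _

/-- The link `hg` from the last triple to the `g`-translate of the first is invariant under
translation, so it joins every two consecutive copies of the base chain. -/
lemma chainFromTo_lift {bs : List (Fin 3 → ℤ)} {σ ρ : Fin 3 → ℤ} {g : ℤ}
    (h : ChainFromTo (ShareMod N) bs σ ρ) (hg : ShareMod N ρ (fun i => g + σ i)) (a m : ℕ) :
    ChainFromTo Share (lift N K bs g a (m + 1)) (blk N K ((a : ZMod N) * g) σ)
      (blk N K (((a + m : ℕ) : ZMod N) * g) ρ) := by
  refine ChainFromTo.flatMap_range (s := fun j => blk N K (((a + j : ℕ) : ZMod N) * g) σ)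
    (e := fun j => blk N K (((a + j : ℕ) : ZMod N) * g) ρ)
    (fun i _ => h.map _ fun x y hxy => share_blk hxy _) (fun i _ => ?_)
  have : (((a + (i + 1) : ℕ) : ZMod N) * g) = ((a + i : ℕ) : ZMod N) * g + g := by
    push_cast; ring
  rw [this]
  exact share_blk_add hg _

lemma exists_eq_mul_of_isUnit [NeZero N] {g : ZMod N} (hg : IsUnit g) (u : ZMod N) :
    ∃ j < N, u = (j : ZMod N) * g := by
  obtain ⟨h, hh⟩ := hg.exists_left_inv
  refine ⟨(u * h).val, ZMod.val_lt _, ?_⟩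
  rw [ZMod.natCast_zmod_val, mul_assoc, hh, mul_one]

lemma mem_lift {bs : List (Fin 3 → ℤ)} {g : ℤ} {a m j : ℕ} (haj : a ≤ j) (hj : j < a + m)
    {τ : Fin 3 → ℤ} (hτ : τ ∈ bs) : blk N K ((j : ZMod N) * g) τ ∈ lift N K bs g a m := by
  refine List.mem_flatMap.2 ⟨j - a, List.mem_range.2 (by omega), List.mem_map.2 ⟨τ, hτ, ?_⟩⟩
  rw [Nat.add_sub_of_le haj]

/-- The triples `{X, a, a + s}, {X, a + s, a + 2 s}, …`, in number `m`. -/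
def rail (N : ℕ) {K : Type} [DecidableEq K] (X : K) (a s : ZMod N) (m : ℕ) : List (Finset (ZMod N ⊕ K)) :=
  (List.range m).map fun j : ℕ => {Sum.inr X, Sum.inl (a + j * s), Sum.inl (a + (j + 1 : ℕ) * s)}

lemma length_rail (X : K) (a s : ZMod N) (m : ℕ) : (rail N X a s m).length = m := by
  simp [rail]

lemma card_le_of_mem_rail {X : K} {a s : ZMod N} {m : ℕ} {B : Finset (ZMod N ⊕ K)}
    (hB : B ∈ rail N X a s m) : B.card ≤ 3 := by
  obtain ⟨j, -, rfl⟩ := List.mem_map.1 hB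
  exact Finset.card_le_three

lemma chainFromTo_rail (X : K) (a s : ZMod N) (m : ℕ) :
    ChainFromTo Share (rail N X a s (m + 1)) {Sum.inr X, Sum.inl a, Sum.inl (a + s)}
      {Sum.inr X, Sum.inl (a + m * s), Sum.inl (a + (m + 1 : ℕ) * s)} := by
  have h := ChainFromTo.map_range (R := Share) (k := m) (f := fun j : ℕ =>
    ({Sum.inr X, Sum.inl (a + j * s), Sum.inl (a + (j + 1 : ℕ) * s)} : Finset (ZMod N ⊕ K)))
    (fun i _ => ⟨Sum.inr X, Sum.inl (a + (i + 1 : ℕ) * s), _, _,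
      by rw [Finset.pair_comm], rfl⟩)
  simpa [rail] using h

lemma mem_rail [NeZero N] (X : K) (a : ZMod N) {s : ZMod N} (hs : IsUnit s) (w : ZMod N) :
    ({Sum.inr X, Sum.inl w, Sum.inl (w + s)} : Finset (ZMod N ⊕ K)) ∈ rail N X a s N := by
  obtain ⟨j, hj, h⟩ := exists_eq_mul_of_isUnit hs (w - a)
  have hw : w = a + j * s := by rw [← h]; ring
  refine List.mem_map.2 ⟨j, List.mem_range.2 hj, ?_⟩
  rw [hw]
  push_cast
  ring_nf

/-- A unit step visits all residues, so `N` steps close up. With `N - 1` steps only the edge from `a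
- s` back to `a` is absent. -/
lemma mem_rail_sub_one [NeZero N] (X : K) (a : ZMod N) {s : ZMod N} (hs : IsUnit s) {w : ZMod N}
    (hw : w + s ≠ a) :
    ({Sum.inr X, Sum.inl w, Sum.inl (w + s)} : Finset (ZMod N ⊕ K)) ∈ rail N X a s (N - 1) := by
  obtain ⟨j, hj, h⟩ := exists_eq_mul_of_isUnit hs (w - a)
  have hw' : w = a + j * s := by rw [← h]; ring
  have hjN : j ≠ N - 1 := by
    rintro rfl
    apply hw
    rw [hw', Nat.cast_sub (NeZero.one_le), ZMod.natCast_self]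
    ring
  refine List.mem_map.2 ⟨j, List.mem_range.2 (by omega), ?_⟩
  rw [hw']
  push_cast
  ring_nf

/-! ### Covering pairs of points -/

/-- Some translate of `τ` is `{0, δ, ζ}` modulo `N`. -/
def CoversDiff (N : ℕ) (τ : Fin 3 → ℤ) (δ ζ : ℤ) : Prop :=
  ∃ i j k : Fin 3, i ≠ j ∧ i ≠ k ∧ j ≠ k ∧ (N : ℤ) ∣ τ j - τ i - δ ∧ (N : ℤ) ∣ τ k - τ i - ζ

/-- The difference `δ` occurs in two different ways, in a translate of a member of `bs` and in a
translate of a member of `bs` or of `ρ`. -/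
def TwiceCovered (N : ℕ) (bs : List (Fin 3 → ℤ)) (ρ : Fin 3 → ℤ) (δ : ℤ) : Prop :=
  ∃ ζ ζ' : ℤ, (∃ τ ∈ bs, CoversDiff N τ δ ζ) ∧ (∃ σ, (σ ∈ bs ∨ σ = ρ) ∧ CoversDiff N σ δ ζ') ∧
    ¬ (N : ℤ) ∣ ζ' - ζ ∧ ¬ (N : ℤ) ∣ ζ ∧ ¬ (N : ℤ) ∣ ζ - δ

lemma CoversDiff.exists_blk {τ : Fin 3 → ℤ} {δ ζ : ℤ} (h : CoversDiff N τ δ ζ) (a : ZMod N) :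
    ∃ u : ZMod N, ∃ i j : Fin 3, i ≠ j ∧ a = u + τ i ∧ a + δ = u + τ j ∧
      blk N K u τ = {Sum.inl a, Sum.inl (a + δ), Sum.inl (a + ζ)} := by
  obtain ⟨i, j, k, hij, hik, hjk, h1, h2⟩ := h
  have h1' := intCast_eq_of_dvd h1
  have h2' := intCast_eq_of_dvd h2
  push_cast at h1' h2'
  refine ⟨a - τ i, i, j, hij, by ring, by rw [h1']; ring, ?_⟩
  rw [blk_eq _ _ hij hik hjk, h1', h2']
  ring_nf

/-- The third point `a + ζ` of the first translate does not lie in the second, so the two differ.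
The form of `hρ` lets translates of `ρ` be replaced by blocks with an outer point, which are never
translates. -/
lemma exists_two_of_twiceCovered {bs : List (Fin 3 → ℤ)} {ρ : Fin 3 → ℤ}
    {L : List (Finset (ZMod N ⊕ K))} (hT : ∀ τ ∈ bs, ∀ u, blk N K u τ ∈ L)
    (hρ : ∀ u : ZMod N, ∀ i j : Fin 3, i ≠ j → ∃ B ∈ L, Sum.inl (u + ρ i) ∈ B ∧ Sum.inl (u + ρ j) ∈ B ∧
      (B = blk N K u ρ ∨ ∃ k, Sum.inr k ∈ B))
    {δ : ℤ} (h : TwiceCovered N bs ρ δ) (a : ZMod N) :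
    ∃ B ∈ L, ∃ C ∈ L, B ≠ C ∧ (Sum.inl a ∈ B ∧ Sum.inl (a + δ) ∈ B) ∧
      (Sum.inl a ∈ C ∧ Sum.inl (a + δ) ∈ C) := by
  obtain ⟨ζ, ζ', ⟨τ, hτ, hc⟩, ⟨σ, hσ, hc'⟩, h1, h2, h3⟩ := h
  obtain ⟨u, i, j, hij, hi, hj, hu⟩ := hc.exists_blk (K := K) a
  obtain ⟨u', i', j', hij', hi', hj', hu'⟩ := hc'.exists_blk (K := K) a
  have hne : blk N K u τ ≠ blk N K u' σ := by
    intro h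
    rw [hu, hu'] at h
    have hm : Sum.inl (a + (ζ : ZMod N)) ∈
        ({Sum.inl a, Sum.inl (a + δ), Sum.inl (a + ζ')} : Finset (ZMod N ⊕ K)) := by
      rw [← h]; simp
    simp only [Finset.mem_insert, Finset.mem_singleton, Sum.inl.injEq, add_right_inj,
      add_eq_left] at hm
    rcases hm with hm | hm | hm
    · exact h2 ((ZMod.intCast_zmod_eq_zero_iff_dvd ζ N).1 hm)
    · exact h3 ((ZMod.intCast_eq_intCast_iff_dvd_sub _ _ N).1 hm.symm)
    · exact h1 ((ZMod.intCast_eq_intCast_iff_dvd_sub _ _ N).1 hm)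
  have hB : Sum.inl a ∈ blk N K u τ ∧ Sum.inl (a + (δ : ZMod N)) ∈ blk N K u τ := by
    rw [hu]; simp
  rcases hσ with hσ | rfl
  · exact ⟨_, hT τ hτ u, _, hT σ hσ u', hne, hB, by rw [hu']; simp⟩
  · obtain ⟨C, hC, hC1, hC2, hC3⟩ := hρ u' i' j' hij'
    refine ⟨_, hT τ hτ u, C, hC, ?_, hB, by rw [hi']; exact hC1, by rw [hj']; exact hC2⟩
    rcases hC3 with rfl | ⟨k, hk⟩
    · exact hne
    · rintro rfl
      exact inr_notMem_blk _ _ _ hk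

lemma exists_intCast_of_ne [NeZero N] {a b : ZMod N} (hab : a ≠ b) :
    ∃ δ : ℤ, 1 ≤ δ ∧ 2 * δ ≤ N ∧ (b = a + δ ∨ a = b + δ) := by
  have hlt := ZMod.val_lt (b - a)
  have hpos : 0 < (b - a).val := by
    rw [Nat.pos_iff_ne_zero, Ne, ZMod.val_eq_zero, sub_eq_zero]
    exact hab.symm
  have hval : (((b - a).val : ℤ) : ZMod N) = b - a := by
    rw [Int.cast_natCast, ZMod.natCast_zmod_val]
  by_cases h : 2 * (b - a).val ≤ N
  · exact ⟨(b - a).val, by omega, by omega, Or.inl (by rw [hval]; ring)⟩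
  · refine ⟨N - (b - a).val, by omega, by omega, Or.inr ?_⟩
    rw [Int.cast_sub, hval, Int.cast_natCast, ZMod.natCast_self]
    ring

end Translates

lemma exists_two_of_forall_diff {N : ℕ} {K : Type} [NeZero N] {L : List (Finset (ZMod N ⊕ K))}
    (h : ∀ δ : ℤ, 1 ≤ δ → 2 * δ ≤ N → ∀ a : ZMod N, ∃ B ∈ L, ∃ C ∈ L, B ≠ C ∧
      (Sum.inl a ∈ B ∧ Sum.inl (a + δ) ∈ B) ∧ (Sum.inl a ∈ C ∧ Sum.inl (a + δ) ∈ C))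
    {a b : ZMod N} (hab : a ≠ b) : ∃ B ∈ L, ∃ C ∈ L, B ≠ C ∧
      (Sum.inl a ∈ B ∧ Sum.inl b ∈ B) ∧ (Sum.inl a ∈ C ∧ Sum.inl b ∈ C) := by
  obtain ⟨δ, h1, h2, rfl | rfl⟩ := exists_intCast_of_ne hab
  · exact h δ h1 h2 a
  · obtain ⟨B, hB, C, hC, hne, hB', hC'⟩ := h δ h1 h2 b
    exact ⟨B, hB, C, hC, hne, hB'.symm, hC'.symm⟩


/-! ### The zigzag -/

/-- The zigzag `b, b - t + 1, b - 1, b - t + 2, …`, whose first `t` terms run through the interval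
`[b - t + 1, b]` with steps of lengths `t - 1, t - 2, …, 1`. -/
def zig (b t : ℤ) (i : ℕ) : ℤ := if i % 2 = 0 then b - i / 2 else b - t + (i + 1) / 2

lemma zig_mem {b t : ℤ} {i : ℕ} (hi : (i : ℤ) < t) : b - t < zig b t i ∧ zig b t i ≤ b := by
  unfold zig
  split_ifs <;> omega

lemma exists_zig_eq {b t x : ℤ} (h1 : b - t < x) (h2 : x ≤ b) :
    ∃ i : ℕ, (i : ℤ) < t ∧ zig b t i = x := by
  by_cases h : 2 * (b - x) < t
  · refine ⟨(2 * (b - x)).toNat, by omega, ?_⟩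
    rw [zig, if_pos (by omega)]
    omega
  · refine ⟨(2 * (x - b + t) - 1).toNat, by omega, ?_⟩
    rw [zig, if_neg (by omega)]
    omega

lemma zig_zero (b t : ℤ) : zig b t 0 = b := by simp [zig]

lemma zig_one (b t : ℤ) : zig b t 1 = b - t + 1 := by simp [zig]

lemma zig_step {b t : ℤ} {i : ℕ} :
    (i % 2 = 0 → zig b t i = zig b t (i + 1) + (t - 1 - i)) ∧
    (i % 2 = 1 → zig b t (i + 1) = zig b t i + (t - 1 - i)) := by
  unfold zig
  constructor <;> intro h <;> split_ifs <;> omega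

lemma zig_step_ne {b t : ℤ} {i : ℕ} (hi : (i : ℤ) + 1 < t) :
    zig b t i ≠ zig b t (i + 1) := by
  unfold zig
  split_ifs <;> omega

/-- Two consecutive fan triples share a spoke; this separates their third points. -/
lemma zig_add_two_ne {b t : ℤ} {i : ℕ} : zig b t (i + 2) - zig b t i = 1 ∨
    zig b t (i + 2) - zig b t i = -1 := by
  unfold zig
  split_ifs <;> omega

lemma not_dvd_of_lt {N : ℕ} {d : ℤ} (h : (0 < d ∧ d < N) ∨ (-N < d ∧ d < 0)) : ¬ (N : ℤ) ∣ d := by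
  intro hd
  rcases h with ⟨h1, h2⟩ | ⟨h1, h2⟩
  · exact absurd (Int.le_of_dvd h1 hd) (by omega)
  · exact absurd (Int.le_of_dvd (by omega) ((dvd_neg).2 hd)) (by omega)

lemma isUnit_intCast_of_dvd {N : ℕ} {a : ℤ} (b : ℤ) (h : (N : ℤ) ∣ 1 - a * b) :
    IsUnit (a : ZMod N) := by
  have h := intCast_eq_of_dvd h
  push_cast at h
  exact IsUnit.of_mul_eq_one _ h

lemma CoversDiff.of_eq {N : ℕ} {τ : Fin 3 → ℤ} {δ ζ : ℤ} (i j k : Fin 3) (hij : i ≠ j)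
    (hik : i ≠ k) (hjk : j ≠ k) (h1 : δ = τ j - τ i) (h2 : ζ = τ k - τ i) :
    CoversDiff N τ δ ζ :=
  ⟨i, j, k, hij, hik, hjk, ⟨0, by rw [h1]; ring⟩, ⟨0, by rw [h2]; ring⟩⟩

/-! ### Base triples modulo `6 t + 1` -/

/-- The base triples modulo `6 t + 1` other than `{t, 3 t, 0}`, in the order in which they are
passed. -/
def fan (t : ℕ) : List (Fin 3 → ℤ) :=
  (List.range (t - 1)).map (fun i => ![0, zig (2 * t) t i, zig (2 * t) t (i + 1)]) ++
  ([![0, zig (2 * t) t (t - 1), zig (2 * t) t (t - 1) + t]] ++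
  (List.range (t - 1)).map (fun i =>
    ![0, zig (2 * t) t (t - 2 - i) + t, zig (2 * t) t (t - 2 - i + 1) + t]))

lemma length_fan {t : ℕ} (ht : 2 ≤ t) : (fan t).length = 2 * t - 1 := by
  simp [fan]
  omega

/-- All triples pivot about 0. The first zigzag fills [t+1, 2t]; the middle triple jumps by t from
its end to the end of its copy in [2t+1, 3t], which is run backwards. -/
lemma chainFromTo_fan (N : ℕ) {t : ℕ} (ht : 2 ≤ t) :
    ChainFromTo (ShareMod N) (fan t) ![0, 2 * t, t + 1] ![0, 3 * t, 2 * t + 1] := by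
  obtain ⟨k, rfl⟩ := Nat.exists_eq_add_of_le' ht
  have hF : ChainFromTo (ShareMod N) _ _ _ := ChainFromTo.map_range (k := k)
    (f := fun i => ![0, zig (2 * (k + 2 : ℕ)) (k + 2 : ℕ) i, zig (2 * (k + 2 : ℕ)) (k + 2 : ℕ) (i + 1)])
    (R := ShareMod N) (fun i _ => ShareMod.of_eq 0 2 0 1 (by decide) (by decide) rfl rfl)
  have hG : ChainFromTo (ShareMod N) _ _ _ := ChainFromTo.map_range (k := k)
    (f := fun i => ![0, zig (2 * (k + 2 : ℕ)) (k + 2 : ℕ) (k - i) + (k + 2 : ℕ),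
      zig (2 * (k + 2 : ℕ)) (k + 2 : ℕ) (k - i + 1) + (k + 2 : ℕ)])
    (R := ShareMod N) (fun i hi => ShareMod.of_eq 0 1 0 2 (by decide) (by decide) rfl (by
      have : k - i = k - (i + 1) + 1 := by omega
      simp [this]))
  have h := hF.append ((ChainFromTo.singleton ![0, zig (2 * (k + 2 : ℕ)) (k + 2 : ℕ) (k + 1),
    zig (2 * (k + 2 : ℕ)) (k + 2 : ℕ) (k + 1) + (k + 2 : ℕ)]).append hG
    (ShareMod.of_eq 0 2 0 2 (by decide) (by decide) rfl (by simp)))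
    (ShareMod.of_eq 0 2 0 1 (by decide) (by decide) rfl rfl)
  have e1 : (2 * (k + 2 : ℕ) - (k + 2 : ℕ) + 1 : ℤ) = (k + 2 : ℕ) + 1 := by ring
  have e2 : (2 * (k + 2 : ℕ) + (k + 2 : ℕ) : ℤ) = 3 * (k + 2 : ℕ) := by ring
  have e3 : ((k + 2 : ℕ) + 1 + (k + 2 : ℕ) : ℤ) = 2 * (k + 2 : ℕ) + 1 := by ring
  simp only [zig_zero, zig_one, Nat.sub_self, zero_add, e1, e2, e3] at h
  exact h

lemma fan_left_mem {t i : ℕ} (hi : i + 1 < t) :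
    ![0, zig (2 * t) t i, zig (2 * t) t (i + 1)] ∈ fan t :=
  List.mem_append_left _ (List.mem_map.2 ⟨i, List.mem_range.2 (by omega), rfl⟩)

lemma fan_middle_mem {t : ℕ} :
    ![0, zig (2 * t) t (t - 1), zig (2 * t) t (t - 1) + t] ∈ fan t :=
  List.mem_append_right _ (List.mem_append_left _ (List.mem_singleton_self _))

lemma fan_right_mem {t i : ℕ} (hi : i + 1 < t) :
    ![0, zig (2 * t) t i + t, zig (2 * t) t (i + 1) + t] ∈ fan t := by
  refine List.mem_append_right _ (List.mem_append_right _
    (List.mem_map.2 ⟨t - 2 - i, List.mem_range.2 (by omega), ?_⟩))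
  rw [show t - 2 - (t - 2 - i) = i by omega]

/-- A step below t occurs in both zigzags, an inner spoke in two neighbouring triples. The
difference t occurs in the middle triple and in {t, 3t, 0}, whose other differences 2t and 3t
complete the two end spokes. -/
lemma twiceCovered_fan {t : ℕ} (ht : 2 ≤ t) {δ : ℤ} (h1 : 1 ≤ δ) (h2 : δ ≤ 3 * t) :
    TwiceCovered (6 * t + 1) (fan t) ![(t : ℤ), 3 * t, 0] δ := by
  rcases lt_trichotomy δ t with h | h | h
  -- The i-th step of the zigzag has length t - 1 - i.
  · obtain ⟨i, hi⟩ : ∃ i : ℕ, (i : ℤ) = t - 1 - δ := ⟨(t - 1 - δ).toNat, by omega⟩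
    have hx := zig_mem (b := 2 * t) (t := t) (i := i) (by omega)
    have hy := zig_mem (b := 2 * t) (t := t) (i := i + 1) (by omega)
    obtain ⟨he, ho⟩ := zig_step (b := 2 * t) (t := t) (i := i)
    have hl := fan_left_mem (t := t) (i := i) (by omega)
    have hr := fan_right_mem (t := t) (i := i) (by omega)
    rcases Nat.mod_two_eq_zero_or_one i with h0 | h0
    · have he := he h0
      refine ⟨-zig (2 * t) t (i + 1), -(zig (2 * t) t (i + 1) + t),
        ⟨_, hl, .of_eq 2 1 0 (by decide) (by decide) (by decide) (by simp; omega) (by simp)⟩,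
        ⟨_, Or.inl hr, .of_eq 2 1 0 (by decide) (by decide) (by decide) (by simp; omega)
          (by simp)⟩, ?_, ?_, ?_⟩ <;> apply not_dvd_of_lt <;> push_cast <;> omega
    · have ho := ho h0
      refine ⟨-zig (2 * t) t i, -(zig (2 * t) t i + t),
        ⟨_, hl, .of_eq 1 2 0 (by decide) (by decide) (by decide) (by simp; omega) (by simp)⟩,
        ⟨_, Or.inl hr, .of_eq 1 2 0 (by decide) (by decide) (by decide) (by simp; omega)
          (by simp)⟩, ?_, ?_, ?_⟩ <;> apply not_dvd_of_lt <;> push_cast <;> omega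
  · have hx := zig_mem (b := 2 * t) (t := t) (i := t - 1) (by omega)
    refine ⟨-zig (2 * t) t (t - 1), 3 * t, ⟨_, fan_middle_mem, .of_eq 1 2 0 (by decide) (by decide)
      (by decide) (by simp; omega) (by simp)⟩, ⟨_, Or.inr rfl, .of_eq 2 0 1 (by decide) (by decide)
      (by decide) (by simp; omega) (by simp)⟩, ?_, ?_, ?_⟩ <;> apply not_dvd_of_lt <;>
      push_cast <;> omega
  · obtain ⟨i, hi, hδ⟩ : ∃ i : ℕ, (i : ℤ) < t ∧
        (δ = zig (2 * t) t i ∨ δ = zig (2 * t) t i + t) := by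
      by_cases hδ : δ ≤ 2 * t
      · obtain ⟨i, hi, h⟩ := exists_zig_eq (b := 2 * t) (t := t) (x := δ) (by omega) hδ
        exact ⟨i, hi, Or.inl h.symm⟩
      · obtain ⟨i, hi, h⟩ := exists_zig_eq (b := 2 * t) (t := t) (x := δ - t) (by omega) (by omega)
        exact ⟨i, hi, Or.inr (by omega)⟩
    have hx := zig_mem (b := 2 * t) hi
    rcases Nat.eq_zero_or_pos i with rfl | hi0
    · have hy := zig_one (2 * t) t
      have hz := zig_zero (2 * t) t
      rcases hδ with hδ | hδ
      · refine ⟨zig (2 * t) t 1, -t, ⟨_, fan_left_mem (i := 0) (by omega), .of_eq 0 1 2 (by decide)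
          (by decide) (by decide) (by simpa using hδ) (by simp)⟩, ⟨_, Or.inr rfl, .of_eq 0 1 2
          (by decide) (by decide) (by decide) (by simp; omega) (by simp)⟩, ?_, ?_, ?_⟩ <;>
          apply not_dvd_of_lt <;> push_cast <;> omega
      · refine ⟨zig (2 * t) t 1 + t, t, ⟨_, fan_right_mem (i := 0) (by omega), .of_eq 0 1 2
          (by decide) (by decide) (by decide) (by simpa using hδ) (by simp)⟩, ⟨_, Or.inr rfl,
          .of_eq 2 1 0 (by decide) (by decide) (by decide) (by simp; omega) (by simp)⟩,
          ?_, ?_, ?_⟩ <;> apply not_dvd_of_lt <;> push_cast <;> omega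
    · obtain ⟨j, rfl⟩ : ∃ j, i = j + 1 := ⟨i - 1, by omega⟩
      have hy := zig_mem (b := 2 * t) (t := t) (i := j) (by omega)
      have hs := zig_step_ne (b := 2 * t) (t := t) (i := j) (by omega)
      -- At the last vertex the second triple on the spoke is the middle one.
      by_cases hjt : j + 2 = t
      · have hm := fan_middle_mem (t := t)
        rw [show t - 1 = j + 1 by omega] at hm
        rcases hδ with hδ | hδ
        · refine ⟨zig (2 * t) t (j + 1) + t, zig (2 * t) t j, ⟨_, hm, .of_eq 0 1 2 (by decide)
            (by decide) (by decide) (by simpa using hδ) (by simp)⟩, ⟨_, Or.inl (fan_left_mem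
            (i := j) (by omega)), .of_eq 0 2 1 (by decide) (by decide) (by decide)
            (by simpa using hδ) (by simp)⟩, ?_, ?_, ?_⟩ <;> apply not_dvd_of_lt <;> push_cast <;>
            omega
        · refine ⟨zig (2 * t) t (j + 1), zig (2 * t) t j + t, ⟨_, hm, .of_eq 0 2 1 (by decide)
            (by decide) (by decide) (by simpa using hδ) (by simp)⟩, ⟨_, Or.inl (fan_right_mem
            (i := j) (by omega)), .of_eq 0 2 1 (by decide) (by decide) (by decide)
            (by simpa using hδ) (by simp)⟩, ?_, ?_, ?_⟩ <;> apply not_dvd_of_lt <;> push_cast <;>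
            omega
      · have hz := zig_mem (b := 2 * t) (t := t) (i := j + 2) (by push_cast; omega)
        have hzs : zig (2 * t) t (j + 2) ≠ zig (2 * t) t (j + 1) :=
          (zig_step_ne (by push_cast; omega)).symm
        have hne := zig_add_two_ne (b := 2 * t) (t := t) (i := j)
        rcases hδ with hδ | hδ
        · refine ⟨zig (2 * t) t (j + 2), zig (2 * t) t j, ⟨_, fan_left_mem (i := j + 1) (by omega),
            .of_eq 0 1 2 (by decide) (by decide) (by decide) (by simpa using hδ) (by simp)⟩,
            ⟨_, Or.inl (fan_left_mem (i := j) (by omega)), .of_eq 0 2 1 (by decide) (by decide)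
            (by decide) (by simpa using hδ) (by simp)⟩, ?_, ?_, ?_⟩ <;> apply not_dvd_of_lt <;>
            push_cast <;> omega
        · refine ⟨zig (2 * t) t (j + 2) + t, zig (2 * t) t j + t, ⟨_, fan_right_mem (i := j + 1)
            (by omega), .of_eq 0 1 2 (by decide) (by decide) (by decide) (by simpa using hδ)
            (by simp)⟩, ⟨_, Or.inl (fan_right_mem (i := j) (by omega)), .of_eq 0 2 1 (by decide)
            (by decide) (by decide) (by simpa using hδ) (by simp)⟩, ?_, ?_, ?_⟩ <;>
            apply not_dvd_of_lt <;> push_cast <;> omega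

/-! ### Gray codes on residues and outer points -/

/-- There is a twofold triple system on `v` points whose `2`-block-intersection graph has a
Hamilton path. -/
def HasGrayCode (v : ℕ) : Prop :=
  ∃ (V : Type) (_ : Fintype V) (_ : DecidableEq V) (T : TwofoldTripleSystem V),
    Fintype.card V = v ∧ HasHamiltonPath (T.blockIntersectionGraph 2)

lemma ChainFromTo.hasGrayCode {N c : ℕ} [NeZero N] {L : List (Finset (ZMod N ⊕ Fin c))}
    {s e : Finset (ZMod N ⊕ Fin c)} (hL : ChainFromTo Share L s e)
    (hcard : ∀ B ∈ L, B.card ≤ 3) (hlen : 3 * L.length = (N + c) * (N + c - 1))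
    (hcov : ∀ a b : ZMod N, a ≠ b → ∃ B ∈ L, ∃ C ∈ L, B ≠ C ∧
      (Sum.inl a ∈ B ∧ Sum.inl b ∈ B) ∧ (Sum.inl a ∈ C ∧ Sum.inl b ∈ C))
    (hcov' : ∀ (X : Fin c) (b : ZMod N), ∃ B ∈ L, ∃ C ∈ L, B ≠ C ∧
      (Sum.inr X ∈ B ∧ Sum.inl b ∈ B) ∧ (Sum.inr X ∈ C ∧ Sum.inl b ∈ C))
    (hcov'' : ∀ X Y : Fin c, X ≠ Y → ∃ B ∈ L, ∃ C ∈ L, B ≠ C ∧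
      (Sum.inr X ∈ B ∧ Sum.inr Y ∈ B) ∧ (Sum.inr X ∈ C ∧ Sum.inr Y ∈ C)) :
    HasGrayCode (N + c) := by
  have hV : Fintype.card (ZMod N ⊕ Fin c) = N + c := by simp [ZMod.card]
  obtain ⟨T, hT⟩ := exists_grayCode_of_list L (by rintro rfl; simpa using hL.2.1) hcard
    (by rw [hV, hlen]) (by
      rintro (a | X) (b | Y) hne
      · exact hcov a b fun h => hne (by rw [h])
      · obtain ⟨B, hB, C, hC, h, h1, h2⟩ := hcov' Y a
        exact ⟨B, hB, C, hC, h, h1.symm, h2.symm⟩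
      · exact hcov' X b
      · exact hcov'' X Y fun h => hne (by rw [h])) hL.1
  exact ⟨_, inferInstance, inferInstance, T, hV, hT⟩

/-! ### Three rails closed to a ring -/

section Ring

variable {N : ℕ} {K : Type} [DecidableEq K]

/-- Three rails with the differences of the triple `ρ`, without the three edges of the translate of
`ρ` by `u`, joined by the blocks that contain a point of this translate and two of `A`, `B`, `C`. -/
def ring (A B C : K) (u : ZMod N) (ρ : Fin 3 → ℤ) : List (Finset (ZMod N ⊕ K)) :=
  [{Sum.inr A, Sum.inr B, Sum.inl (u + ρ 0)}] ++
  (rail N B (u + ρ 0) ((ρ 0 - ρ 2 : ℤ) : ZMod N) (N - 1) ++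
  ([{Sum.inr B, Sum.inr C, Sum.inl (u + ρ 2)}] ++
  (rail N C (u + ρ 2) ((ρ 2 - ρ 1 : ℤ) : ZMod N) (N - 1) ++
  ([{Sum.inr C, Sum.inr A, Sum.inl (u + ρ 1)}] ++
  rail N A (u + ρ 1) ((ρ 1 - ρ 0 : ℤ) : ZMod N) (N - 1)))))

lemma mem_ring_iff {A B C : K} {u : ZMod N} {ρ : Fin 3 → ℤ} {D : Finset (ZMod N ⊕ K)} :
    D ∈ ring A B C u ρ ↔ D = {Sum.inr A, Sum.inr B, Sum.inl (u + ρ 0)} ∨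
      D ∈ rail N B (u + ρ 0) ((ρ 0 - ρ 2 : ℤ) : ZMod N) (N - 1) ∨
      D = {Sum.inr B, Sum.inr C, Sum.inl (u + ρ 2)} ∨
      D ∈ rail N C (u + ρ 2) ((ρ 2 - ρ 1 : ℤ) : ZMod N) (N - 1) ∨
      D = {Sum.inr C, Sum.inr A, Sum.inl (u + ρ 1)} ∨
      D ∈ rail N A (u + ρ 1) ((ρ 1 - ρ 0 : ℤ) : ZMod N) (N - 1) := by
  simp only [ring, List.mem_append, List.mem_singleton]

lemma length_ring [NeZero N] (A B C : K) (u : ZMod N) (ρ : Fin 3 → ℤ) :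
    (ring A B C u ρ).length = 3 * N := by
  have := NeZero.one_le (n := N)
  simp [ring, length_rail]
  omega

lemma card_le_of_mem_ring {A B C : K} {u : ZMod N} {ρ : Fin 3 → ℤ} {D : Finset (ZMod N ⊕ K)}
    (hD : D ∈ ring A B C u ρ) : D.card ≤ 3 := by
  rcases mem_ring_iff.1 hD with rfl | hD | rfl | hD | rfl | hD
  on_goal 2 => exact card_le_of_mem_rail hD
  on_goal 3 => exact card_le_of_mem_rail hD
  on_goal 4 => exact card_le_of_mem_rail hD
  all_goals exact Finset.card_le_three

lemma chainFromTo_rail_pred (hN : 2 ≤ N) (X : K) (a s : ZMod N) :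
    ChainFromTo Share (rail N X a s (N - 1)) {Sum.inr X, Sum.inl a, Sum.inl (a + s)}
      {Sum.inr X, Sum.inl (a - s), Sum.inl (a - s - s)} := by
  obtain ⟨m, rfl⟩ := Nat.exists_eq_add_of_le' hN
  have h := chainFromTo_rail X a s m
  have h0 : ((m : ZMod (m + 2))) = -2 := by
    have := ZMod.natCast_self (m + 2)
    push_cast at this
    linear_combination this
  have e1 : a + (m : ZMod (m + 2)) * s = a - s - s := by rw [h0]; ring
  have e2 : a + ((m + 1 : ℕ) : ZMod (m + 2)) * s = a - s := by push_cast; rw [h0]; ring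
  rw [e1, e2, Finset.pair_comm (Sum.inl (a - s - s))] at h
  exact h

/-- Cutting the edge of the kept translate leaves each rail running between two vertices of that
translate. The corner block at the end vertex contains the outer points of this rail and the next,
so the chain turns the corner there. -/
lemma chainFromTo_ring (hN : 2 ≤ N) (A B C : K) (u : ZMod N) (ρ : Fin 3 → ℤ) :
    ChainFromTo Share (ring A B C u ρ) {Sum.inr A, Sum.inr B, Sum.inl (u + ρ 0)}
      {Sum.inr A, Sum.inl (u + ρ 0), Sum.inl (u + ρ 0 - (ρ 1 - ρ 0 : ℤ))} := by
  have key : ∀ (X Y : K) (i j : Fin 3),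
      ChainFromTo Share ([{Sum.inr X, Sum.inr Y, Sum.inl (u + ρ i)}] ++
        rail N Y (u + ρ i) ((ρ i - ρ j : ℤ) : ZMod N) (N - 1))
        {Sum.inr X, Sum.inr Y, Sum.inl (u + ρ i)}
        {Sum.inr Y, Sum.inl (u + ρ j), Sum.inl (u + ρ j - (ρ i - ρ j : ℤ))} := by
    intro X Y i j
    have h := chainFromTo_rail_pred hN Y (u + ρ i) ((ρ i - ρ j : ℤ) : ZMod N)
    have e : u + ρ i - ((ρ i - ρ j : ℤ) : ZMod N) = u + ρ j := by push_cast; ring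
    rw [e] at h
    refine (ChainFromTo.singleton _).append h
      ⟨Sum.inr Y, Sum.inl (u + ρ i), Sum.inr X, _, ?_, rfl⟩
    rw [Finset.insert_comm, Finset.pair_comm (Sum.inr X)]
  have hs : ∀ (X Y : K) (a b : ZMod N ⊕ K),
      Share ({Sum.inr X, a, b} : Finset (ZMod N ⊕ K)) {Sum.inr X, Sum.inr Y, a} :=
    fun X Y a b => ⟨Sum.inr X, a, b, Sum.inr Y, rfl, by rw [Finset.pair_comm]⟩
  have h := (key A B 0 2).append ((key B C 2 1).append (key C A 1 0) (hs _ _ _ _))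
    (hs _ _ _ _)
  simpa only [List.append_assoc, ring] using h

lemma exists_two_of_rail [NeZero N] {L : List (Finset (ZMod N ⊕ K))} {X Y Z : K} {a b : ZMod N}
    {s : ZMod N} (hab : a - s = b) (hs : IsUnit s) (h2 : s + s ≠ 0)
    (hr : ∀ B ∈ rail N X a s (N - 1), B ∈ L) (hY : {Sum.inr X, Sum.inr Y, Sum.inl a} ∈ L)
    (hZ : {Sum.inr Z, Sum.inr X, Sum.inl b} ∈ L) (hXY : X ≠ Y) (hXZ : X ≠ Z) (w : ZMod N) :
    ∃ B ∈ L, ∃ C ∈ L, B ≠ C ∧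
      (Sum.inr X ∈ B ∧ Sum.inl w ∈ B) ∧ (Sum.inr X ∈ C ∧ Sum.inl w ∈ C) := by
  have hs0 : s ≠ 0 := by rintro rfl; simp at h2
  have hab' : a ≠ b := by rintro rfl; simp [hs0] at hab
  have up : w ≠ b → {Sum.inr X, Sum.inl w, Sum.inl (w + s)} ∈ L := fun h =>
    hr _ (mem_rail_sub_one X a hs (w := w) (by rintro rfl; simp at hab; exact h hab))
  have down : w ≠ a → {Sum.inr X, Sum.inl (w - s), Sum.inl w} ∈ L := fun h => by
    have := hr _ (mem_rail_sub_one X a hs (w := w - s) (by simpa using h))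
    simpa using this
  -- Inner points lie in two rail triples, and each end lies in one rail triple and one corner
  -- block.
  by_cases ha : w = a
  · subst ha
    refine ⟨_, up hab', _, hY, fun h => ?_, by simp, by simp⟩
    have : Sum.inr Y ∈ ({Sum.inr X, Sum.inl w, Sum.inl (w + s)} : Finset (ZMod N ⊕ K)) := by
      rw [h]; simp
    simp [hXY.symm] at this
  by_cases hb : w = b
  · subst hb
    refine ⟨_, down ha, _, hZ, fun h => ?_, by simp, by simp⟩
    have : Sum.inr Z ∈ ({Sum.inr X, Sum.inl (w - s), Sum.inl w} : Finset (ZMod N ⊕ K)) := by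
      rw [h]; simp
    simp [hXZ.symm] at this
  · refine ⟨_, up hb, _, down ha, fun h => ?_, by simp, by simp⟩
    have : Sum.inl (w + s) ∈ ({Sum.inr X, Sum.inl (w - s), Sum.inl w} : Finset (ZMod N ⊕ K)) := by
      rw [← h]; simp
    simp only [Finset.mem_insert, Finset.mem_singleton, Sum.inl.injEq, reduceCtorEq, false_or,
      add_eq_left, hs0, or_false] at this
    exact h2 (by linear_combination this)

/-- The only edge missing from the rail is the one at `u₀`, and there the kept translate of `ρ`
covers it. -/
lemma exists_of_rail [NeZero N] {L : List (Finset (ZMod N ⊕ K))} {X : K} {u₀ : ZMod N}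
    {ρ : Fin 3 → ℤ} {i j : Fin 3} (hs : IsUnit ((ρ i - ρ j : ℤ) : ZMod N))
    (hr : ∀ B ∈ rail N X (u₀ + ρ i) ((ρ i - ρ j : ℤ) : ZMod N) (N - 1), B ∈ L)
    (hρ : blk N K u₀ ρ ∈ L) (u : ZMod N) :
    ∃ B ∈ L, Sum.inl (u + ρ i) ∈ B ∧ Sum.inl (u + ρ j) ∈ B ∧
      (B = blk N K u ρ ∨ ∃ k, Sum.inr k ∈ B) := by
  by_cases hu : u = u₀
  · subst hu
    exact ⟨_, hρ, mem_blk _ _ _, mem_blk _ _ _, Or.inl rfl⟩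
  · have e : u + ρ j + ((ρ i - ρ j : ℤ) : ZMod N) = u + ρ i := by push_cast; ring
    refine ⟨_, hr _ (mem_rail_sub_one X _ hs (w := u + ρ j) (by rw [e]; simpa using hu)), ?_, ?_,
      Or.inr ⟨X, by simp⟩⟩
    · rw [e]; simp
    · simp

lemma exists_of_ring [NeZero N] {L : List (Finset (ZMod N ⊕ K))} {A B C : K} {u₀ : ZMod N}
    {ρ : Fin 3 → ℤ} (h02 : IsUnit ((ρ 0 - ρ 2 : ℤ) : ZMod N))
    (h21 : IsUnit ((ρ 2 - ρ 1 : ℤ) : ZMod N)) (h10 : IsUnit ((ρ 1 - ρ 0 : ℤ) : ZMod N))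
    (hL : ∀ D ∈ ring A B C u₀ ρ, D ∈ L) (hρ : blk N K u₀ ρ ∈ L) (u : ZMod N) (i j : Fin 3)
    (hij : i ≠ j) :
    ∃ D ∈ L, Sum.inl (u + ρ i) ∈ D ∧ Sum.inl (u + ρ j) ∈ D ∧
      (D = blk N K u ρ ∨ ∃ k, Sum.inr k ∈ D) := by
  have swap : ∀ {i j : Fin 3}, (∃ D ∈ L, Sum.inl (u + ρ i) ∈ D ∧ Sum.inl (u + ρ j) ∈ D ∧
      (D = blk N K u ρ ∨ ∃ k, Sum.inr k ∈ D)) → ∃ D ∈ L, Sum.inl (u + ρ j) ∈ D ∧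
      Sum.inl (u + ρ i) ∈ D ∧ (D = blk N K u ρ ∨ ∃ k, Sum.inr k ∈ D) := by
    rintro i j ⟨D, h1, h2, h3, h4⟩
    exact ⟨D, h1, h3, h2, h4⟩
  have e02 := exists_of_rail (X := B) h02 (fun D hD => hL D (mem_ring_iff.2 (by tauto))) hρ u
  have e21 := exists_of_rail (X := C) h21 (fun D hD => hL D (mem_ring_iff.2 (by tauto))) hρ u
  have e10 := exists_of_rail (X := A) h10 (fun D hD => hL D (mem_ring_iff.2 (by tauto))) hρ u
  fin_cases i <;> fin_cases j <;> first
    | exact absurd rfl hij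
    | exact e02
    | exact e21
    | exact e10
    | exact swap e02
    | exact swap e21
    | exact swap e10

/-- Cancelling the unit would give N ∣ 2. This keeps {X, w - s, w} and {X, w, w + s} apart. -/
lemma add_self_ne_zero_of_isUnit (hN : Odd N) (h1 : N ≠ 1) {s : ZMod N} (hs : IsUnit s) :
    s + s ≠ 0 := by
  intro h
  have h2 : ((2 : ℕ) : ZMod N) = 0 := by
    rw [← two_mul] at h
    push_cast
    exact (hs.mul_left_eq_zero).1 h
  rw [ZMod.natCast_eq_zero_iff] at h2
  obtain ⟨k, hk⟩ := hN
  have := Nat.le_of_dvd (by norm_num) h2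
  interval_cases N <;> omega

lemma exists_two_of_ring [NeZero N] {L : List (Finset (ZMod N ⊕ K))} {A B C : K} {u₀ : ZMod N}
    {ρ : Fin 3 → ℤ} (hN : Odd N) (hN1 : N ≠ 1) (h02 : IsUnit ((ρ 0 - ρ 2 : ℤ) : ZMod N))
    (h21 : IsUnit ((ρ 2 - ρ 1 : ℤ) : ZMod N)) (h10 : IsUnit ((ρ 1 - ρ 0 : ℤ) : ZMod N))
    (hL : ∀ D ∈ ring A B C u₀ ρ, D ∈ L) (hAB : A ≠ B) (hBC : B ≠ C) (hCA : C ≠ A) {X : K}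
    (hX : X = A ∨ X = B ∨ X = C) (w : ZMod N) :
    ∃ D ∈ L, ∃ E ∈ L, D ≠ E ∧
      (Sum.inr X ∈ D ∧ Sum.inl w ∈ D) ∧ (Sum.inr X ∈ E ∧ Sum.inl w ∈ E) := by
  have pc : ∀ (Y Z : K) (x : ZMod N ⊕ K), ({Sum.inr Y, Sum.inr Z, x} : Finset (ZMod N ⊕ K)) =
    {Sum.inr Z, Sum.inr Y, x} := fun Y Z x => Finset.insert_comm _ _ _
  rcases hX with rfl | rfl | rfl
  · exact exists_two_of_rail (N := N) (a := u₀ + ρ 1) (b := u₀ + ρ 0) (Y := C) (Z := B)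
      (by push_cast; ring) h10 (add_self_ne_zero_of_isUnit hN hN1 h10)
      (fun D hD => hL D (mem_ring_iff.2 (by tauto))) (hL _ (by rw [pc]; exact mem_ring_iff.2 (by tauto)))
      (hL _ (by rw [pc]; exact mem_ring_iff.2 (by tauto))) hCA.symm hAB w
  · exact exists_two_of_rail (N := N) (a := u₀ + ρ 0) (b := u₀ + ρ 2) (Y := A) (Z := C)
      (by push_cast; ring) h02 (add_self_ne_zero_of_isUnit hN hN1 h02)
      (fun D hD => hL D (mem_ring_iff.2 (by tauto))) (hL _ (by rw [pc]; exact mem_ring_iff.2 (by tauto)))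
      (hL _ (by rw [pc]; exact mem_ring_iff.2 (by tauto))) hAB.symm hBC w
  · exact exists_two_of_rail (N := N) (a := u₀ + ρ 2) (b := u₀ + ρ 1) (Y := B) (Z := A)
      (by push_cast; ring) h21 (add_self_ne_zero_of_isUnit hN hN1 h21)
      (fun D hD => hL D (mem_ring_iff.2 (by tauto))) (hL _ (by rw [pc]; exact mem_ring_iff.2 (by tauto)))
      (hL _ (by rw [pc]; exact mem_ring_iff.2 (by tauto))) hBC.symm hCA w

lemma exists_corner {A B C X Y : K} {u : ZMod N} {ρ : Fin 3 → ℤ} (hX : X = A ∨ X = B ∨ X = C)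
    (hY : Y = A ∨ Y = B ∨ Y = C) (hXY : X ≠ Y) :
    ∃ D ∈ ring A B C u ρ, ∃ w, Sum.inl w ∈ D ∧ Sum.inr X ∈ D ∧ Sum.inr Y ∈ D := by
  rcases hX with rfl | rfl | rfl <;> rcases hY with rfl | rfl | rfl
  · exact absurd rfl hXY
  · exact ⟨_, mem_ring_iff.2 (Or.inl rfl), u + ρ 0, by simp, by simp, by simp⟩
  · exact ⟨_, mem_ring_iff.2 (Or.inr (Or.inr (Or.inr (Or.inr (Or.inl rfl))))), u + ρ 1, by simp, by simp, by simp⟩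
  · exact ⟨_, mem_ring_iff.2 (Or.inl rfl), u + ρ 0, by simp, by simp, by simp⟩
  · exact absurd rfl hXY
  · exact ⟨_, mem_ring_iff.2 (Or.inr (Or.inr (Or.inl rfl))), u + ρ 2, by simp, by simp, by simp⟩
  · exact ⟨_, mem_ring_iff.2 (Or.inr (Or.inr (Or.inr (Or.inr (Or.inl rfl))))), u + ρ 1, by simp, by simp, by simp⟩
  · exact ⟨_, mem_ring_iff.2 (Or.inr (Or.inr (Or.inl rfl))), u + ρ 2, by simp, by simp, by simp⟩
  · exact absurd rfl hXY

/-- The corner block through the two outer points contains a residue and `E` does not. -/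
lemma exists_two_of_corner {L : List (Finset (ZMod N ⊕ K))} {A B C X Y : K} {u : ZMod N}
    {ρ : Fin 3 → ℤ} (hL : ∀ D ∈ ring A B C u ρ, D ∈ L) (hX : X = A ∨ X = B ∨ X = C)
    (hY : Y = A ∨ Y = B ∨ Y = C) (hXY : X ≠ Y) {E : Finset (ZMod N ⊕ K)} (hE : E ∈ L)
    (hE' : ∀ w, Sum.inl w ∉ E) (hEX : Sum.inr X ∈ E) (hEY : Sum.inr Y ∈ E) :
    ∃ B ∈ L, ∃ C ∈ L, B ≠ C ∧
      (Sum.inr X ∈ B ∧ Sum.inr Y ∈ B) ∧ (Sum.inr X ∈ C ∧ Sum.inr Y ∈ C) := by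
  obtain ⟨D, hD, w, hw, hDX, hDY⟩ := exists_corner (u := u) (ρ := ρ) hX hY hXY
  exact ⟨D, hL D hD, E, hE, fun h => hE' w (h ▸ hw), ⟨hDX, hDY⟩, ⟨hEX, hEY⟩⟩

end Ring

/-! ### `6 t + 1` and `6 t + 4` points -/

lemma isUnit_natCast_of_six_mul_add_one (t : ℕ) : IsUnit (((t : ℤ)) : ZMod (6 * t + 1)) :=
  isUnit_intCast_of_dvd (-6) ⟨1, by push_cast; ring⟩

/-- The triple {t, 3t, 0} shares {0, 3t} with the end of the fan and {t, 3t} with the fan translated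
by t; and t is a unit, since -6t ≡ 1. -/
theorem hasGrayCode_six_mul_add_one {t : ℕ} (ht : 2 ≤ t) : HasGrayCode (6 * t + 1) := by
  have hbs : ChainFromTo (ShareMod (6 * t + 1)) (fan t ++ [![(t : ℤ), 3 * t, 0]])
      ![0, 2 * t, t + 1] ![t, 3 * t, 0] :=
    (chainFromTo_fan _ ht).append (.singleton _)
      (.of_eq 0 1 2 1 (by decide) (by decide) rfl rfl)
  have hL := chainFromTo_lift (K := Fin 0) hbs (g := t)
    (.of_eq 0 1 0 1 (by decide) (by decide) (by simp) (by simp; ring)) 0 (6 * t)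
  have hmem : ∀ τ ∈ fan t ++ [![(t : ℤ), 3 * t, 0]], ∀ u : ZMod (6 * t + 1), blk _ (Fin 0) u τ ∈
      lift (6 * t + 1) (Fin 0) (fan t ++ [![(t : ℤ), 3 * t, 0]]) t 0 (6 * t + 1) := by
    intro τ hτ u
    obtain ⟨j, hj, rfl⟩ := exists_eq_mul_of_isUnit (isUnit_natCast_of_six_mul_add_one t) u
    exact mem_lift (Nat.zero_le _) (by omega) hτ
  refine ChainFromTo.hasGrayCode (N := 6 * t + 1) (c := 0) hL (fun B hB => card_le_of_mem_lift hB) ?_ ?_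
    (fun X => X.elim0) (fun X => X.elim0)
  · obtain ⟨k, rfl⟩ := Nat.exists_eq_add_of_le' ht
    rw [length_lift, List.length_append, length_fan (by omega), List.length_singleton,
      show 2 * (k + 2) - 1 + 1 = 2 * (k + 2) by omega, Nat.add_zero, Nat.add_sub_cancel]
    ring
  · intro a b hab
    refine exists_two_of_forall_diff (fun δ h1 h2 a => ?_) hab
    refine exists_two_of_twiceCovered (fun τ hτ u => hmem τ (List.mem_append_left _ hτ) u)
      (fun u i j _ => ⟨_, hmem _ (List.mem_append_right _ (List.mem_singleton_self _)) u,
        mem_blk _ _ _, mem_blk _ _ _, Or.inl rfl⟩)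
      (twiceCovered_fan ht h1 (by push_cast at h2; omega)) a

/-- The fan also closes without {t, 3t, 0}: its end {0, 3t, 2t+1} shares {3t, 2t+1} with its own
translate by t. So the translates of {t, 3t, 0} can be traded for a ring on three outer points. -/
theorem hasGrayCode_six_mul_add_four {t : ℕ} (ht : 2 ≤ t) : HasGrayCode (6 * t + 4) := by
  have hfan := chainFromTo_fan (6 * t + 1) ht
  have hclose : ShareMod (6 * t + 1) ![0, 3 * t, 2 * t + 1]
      (fun i => (t : ℤ) + (![0, 2 * t, t + 1] : Fin 3 → ℤ) i) :=
    .of_eq 1 2 1 2 (by decide) (by decide) (by simp; ring) (by simp; ring)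
  -- The lift is cut after two copies to insert the kept triple {2t, 4t, t} between the fans
  -- translated by t and 2t.
  have h1 := chainFromTo_lift (K := Fin 3) hfan hclose 0 1
  have h2 := chainFromTo_lift (K := Fin 3) hfan hclose 2 (6 * t - 2)
  -- The offset t makes the ring end on the edge {0, 2t}, which lies in the first fan triple.
  have hring := chainFromTo_ring (N := 6 * t + 1) (by omega) (0 : Fin 3) 1 2 (t : ℤ)
    ![(t : ℤ), 3 * t, 0]
  have hT := h1.append ((ChainFromTo.singleton (R := Share)
      (blk (6 * t + 1) (Fin 3) (t : ℤ) ![(t : ℤ), 3 * t, 0])).append h2 (by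
        have := share_blk_add (N := 6 * t + 1) (K := Fin 3) (τ := ![(t : ℤ), 3 * t, 0])
          (σ := ![0, 2 * t, t + 1]) (g := t)
          (.of_eq 0 1 0 1 (by decide) (by decide) (by simp) (by simp; ring)) (t : ℤ)
        rwa [show (((2 : ℕ) : ZMod (6 * t + 1)) * ((t : ℤ) : ZMod (6 * t + 1))) =
          ((t : ℤ) : ZMod (6 * t + 1)) + ((t : ℤ) : ZMod (6 * t + 1)) by push_cast; ring])) (by
    have := share_blk (N := 6 * t + 1) (K := Fin 3) (τ := ![0, 3 * t, 2 * t + 1])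
      (σ := ![(t : ℤ), 3 * t, 0]) (.of_eq 0 1 2 1 (by decide) (by decide) rfl rfl) (t : ℤ)
    rwa [show (((0 + 1 : ℕ) : ZMod (6 * t + 1)) * ((t : ℤ) : ZMod (6 * t + 1))) =
      ((t : ℤ) : ZMod (6 * t + 1)) by push_cast; ring])
  have hL := ((hring.append hT (by
      refine ⟨Sum.inl ((t : ℤ) + (t : ℤ)), Sum.inl 0, Sum.inr 0, Sum.inl (t + 1), ?_, ?_⟩
      · rw [Finset.insert_comm, Finset.pair_comm (Sum.inr 0)]
        congr 3
        simp
        ring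
      · rw [blk_eq _ _ (i := 1) (j := 0) (k := 2) (by decide) (by decide) (by decide)]
        simp
        ring_nf)).cons (c := {Sum.inr 0, Sum.inr 1, Sum.inr 2})
          ⟨Sum.inr 0, Sum.inr 1, Sum.inr 2, _, rfl, rfl⟩)
  have hmem : ∀ τ ∈ fan t, ∀ u : ZMod (6 * t + 1),
      blk _ (Fin 3) u τ ∈ lift (6 * t + 1) (Fin 3) (fan t) t 0 (1 + 1) ∨
      blk _ (Fin 3) u τ ∈ lift (6 * t + 1) (Fin 3) (fan t) t 2 (6 * t - 2 + 1) := by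
    intro τ hτ u
    obtain ⟨j, hj, rfl⟩ := exists_eq_mul_of_isUnit (isUnit_natCast_of_six_mul_add_one t) u
    rcases Nat.lt_or_ge j 2 with h | h
    · exact Or.inl (mem_lift (Nat.zero_le _) (by omega) hτ)
    · exact Or.inr (mem_lift h (by omega) hτ)
  -- The differences t, -3t, 2t have inverses -6, 2, -3 because -6t ≡ 1.
  have h02 : IsUnit (((![(t : ℤ), 3 * t, 0] : Fin 3 → ℤ) 0 - (![(t : ℤ), 3 * t, 0] : Fin 3 → ℤ) 2 :
      ℤ) : ZMod (6 * t + 1)) := isUnit_intCast_of_dvd (-6) ⟨1, by simp; ring⟩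
  have h21 : IsUnit (((![(t : ℤ), 3 * t, 0] : Fin 3 → ℤ) 2 - (![(t : ℤ), 3 * t, 0] : Fin 3 → ℤ) 1 :
      ℤ) : ZMod (6 * t + 1)) := isUnit_intCast_of_dvd 2 ⟨1, by simp; ring⟩
  have h10 : IsUnit (((![(t : ℤ), 3 * t, 0] : Fin 3 → ℤ) 1 - (![(t : ℤ), 3 * t, 0] : Fin 3 → ℤ) 0 :
      ℤ) : ZMod (6 * t + 1)) := isUnit_intCast_of_dvd (-3) ⟨1, by simp; ring⟩
  refine ChainFromTo.hasGrayCode (N := 6 * t + 1) (c := 3) hL ?_ ?_ ?_ ?_ ?_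
  · intro B hB
    simp only [List.mem_cons, List.mem_append, List.not_mem_nil, or_false] at hB
    rcases hB with rfl | hB | hB | rfl | hB
    · exact Finset.card_le_three
    · exact card_le_of_mem_ring hB
    · exact card_le_of_mem_lift hB
    · exact card_blk_le _ _
    · exact card_le_of_mem_lift hB
  · obtain ⟨k, rfl⟩ := Nat.exists_eq_add_of_le' ht
    simp only [List.length_cons, List.length_append, length_lift, length_ring, length_fan ht,
      List.length_nil]
    rw [show 2 * (k + 2) - 1 = 2 * k + 3 by omega, show 6 * (k + 2) - 2 = 6 * k + 10 by omega,
      show 6 * (k + 2) + 1 + 3 - 1 = 6 * k + 15 by omega]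
    ring
  · intro a b hab
    refine exists_two_of_forall_diff (fun δ h1 h2 a => ?_) hab
    refine exists_two_of_twiceCovered (fun τ hτ u => ?_)
      (fun u i j hij => exists_of_ring (A := 0) (B := 1) (C := 2) (u₀ := (t : ℤ)) h02 h21 h10
        (fun D hD => ?_) ?_ u i j hij)
      (twiceCovered_fan ht h1 (by push_cast at h2; omega)) a
    · have := hmem τ hτ u
      simp only [List.mem_cons, List.mem_append, List.not_mem_nil, or_false]
      tauto
    · exact List.mem_cons_of_mem _ (List.mem_append_left _ hD)
    · simp
  · intro X b
    refine exists_two_of_ring ⟨3 * t, by ring⟩ (by omega) h02 h21 h10 (A := 0) (B := 1) (C := 2)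
      (fun D hD => List.mem_cons_of_mem _ (List.mem_append_left _ hD)) (by decide) (by decide)
      (by decide) ?_ b
    revert X
    decide
  · have h3 : ∀ X : Fin 3, X = 0 ∨ X = 1 ∨ X = 2 := by decide
    have hE : ∀ X : Fin 3, (Sum.inr X : ZMod (6 * t + 1) ⊕ Fin 3) ∈
        ({Sum.inr 0, Sum.inr 1, Sum.inr 2} : Finset (ZMod (6 * t + 1) ⊕ Fin 3)) := by
      intro X
      rcases h3 X with rfl | rfl | rfl <;> simp
    exact fun X Y hXY => exists_two_of_corner
      (fun D hD => List.mem_cons_of_mem _ (List.mem_append_left _ hD)) (h3 X) (h3 Y) hXY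
      List.mem_cons_self (by simp) (hE X) (hE Y)

/-! ### Base triples modulo `6 t - 1` -/

/-- Parameters of the construction modulo `6 t - 1`: the start `b` of the zigzag, the second apex
`c` over its edges, and the point `z` that completes the remaining triple `{0, z, b}`. -/
def Params (t : ℕ) (b c z : ℤ) : Prop :=
  (t % 2 = 1 ∧ b = 2 * t ∧ c = 4 * t ∧ z = -t) ∨ (t % 2 = 0 ∧ b = 3 * t - 1 ∧ c = 4 * t - 1 ∧ z = t)

lemma exists_params (t : ℕ) : ∃ b c z, Params t b c z := by
  rcases Nat.mod_two_eq_zero_or_one t with h | h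
  · exact ⟨_, _, _, Or.inr ⟨h, rfl, rfl, rfl⟩⟩
  · exact ⟨_, _, _, Or.inl ⟨h, rfl, rfl, rfl⟩⟩

/-- The triple with apex `a` over the `i`-th edge of the zigzag. -/
def cone (b : ℤ) (t : ℕ) (a : ℤ) (i : ℕ) : Fin 3 → ℤ := ![a, zig b t i, zig b t (i + 1)]

/-- The triple that contains the end of the zigzag. -/
def endTriple (b c : ℤ) (t : ℕ) : Fin 3 → ℤ := ![0, zig b t (t - 1), c - zig b t (t - 1)]

/-- The base triples modulo `6 t - 1` other than `{0, z, b}`. -/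
def cones (b c : ℤ) (t : ℕ) : List (Fin 3 → ℤ) :=
  endTriple b c t :: ((List.range (t - 1)).map (cone b t 0) ++
    (List.range (t - 2)).map fun i => cone b t c (i + 1))

lemma endTriple_mem (b c : ℤ) (t : ℕ) : endTriple b c t ∈ cones b c t := List.mem_cons_self

lemma cone_zero_mem {b c : ℤ} {t i : ℕ} (hi : i + 1 < t) : cone b t 0 i ∈ cones b c t :=
  List.mem_cons_of_mem _ (List.mem_append_left _
    (List.mem_map.2 ⟨i, List.mem_range.2 (by omega), rfl⟩))

lemma cone_apex_mem {b c : ℤ} {t i : ℕ} (h0 : 1 ≤ i) (hi : i + 1 < t) :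
    cone b t c i ∈ cones b c t :=
  List.mem_cons_of_mem _ (List.mem_append_right _
    (List.mem_map.2 ⟨i - 1, List.mem_range.2 (by omega), by rw [Nat.sub_add_cancel h0]⟩))

lemma mem_cones_cases {b c : ℤ} {t : ℕ} {τ : Fin 3 → ℤ} (hτ : τ ∈ cones b c t) :
    τ = endTriple b c t ∨ (∃ i, i + 1 < t ∧ τ = cone b t 0 i) ∨
      ∃ i, 1 ≤ i ∧ i + 1 < t ∧ τ = cone b t c i := by
  simp only [cones, List.mem_cons, List.mem_append, List.mem_map, List.mem_range] at hτ
  rcases hτ with h | ⟨i, hi, rfl⟩ | ⟨i, hi, rfl⟩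
  · exact Or.inl h
  · exact Or.inr (Or.inl ⟨i, by omega, rfl⟩)
  · exact Or.inr (Or.inr ⟨i + 1, by omega, by omega, rfl⟩)

/-- The end m of the zigzag depends on the parity of t, which is why `Params` has two cases. In
both, c - 2m = ±(t-1), so the end triple {0, m, c-m} supplies the step t-1 that is missing over the
apex c. -/
lemma two_mul_zig_pred {b c z : ℤ} {t : ℕ} (ht : 2 ≤ t) (h : Params t b c z) :
    (t % 2 = 1 ∧ 2 * zig b t (t - 1) = 3 * t + 1) ∨
      (t % 2 = 0 ∧ 2 * zig b t (t - 1) = 5 * t - 2) := by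
  unfold Params at h
  unfold zig
  split_ifs <;> omega

lemma twiceCovered_cones_of_lt {N t : ℕ} (hN : (N : ℤ) = 6 * t - 1) (ht : 2 ≤ t) {b c z : ℤ}
    (hp : Params t b c z) {δ : ℤ} (h1 : 1 ≤ δ) (h2 : δ < t) :
    TwiceCovered N (cones b c t) ![0, z, b] δ := by
  obtain ⟨i, hi⟩ : ∃ i : ℕ, (i : ℤ) = t - 1 - δ := ⟨(t - 1 - δ).toNat, by omega⟩
  have hx := zig_mem (b := b) (t := t) (i := i) (by omega)
  have hy := zig_mem (b := b) (t := t) (i := i + 1) (by omega)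
  have hm := two_mul_zig_pred ht hp
  have h0 := zig_zero b t
  have h1' := zig_one b t
  obtain ⟨he, ho⟩ := zig_step (b := b) (t := t) (i := i)
  have hl := cone_zero_mem (b := b) (c := c) (t := t) (i := i) (by omega)
  unfold Params at hp
  rcases Nat.eq_zero_or_pos i with rfl | hi0
  · rcases hp with hp | hp
    · refine ⟨-zig b t 1, -zig b t (t - 1), ⟨_, hl, .of_eq 2 1 0 (by decide) (by decide)
        (by decide) (by simp [cone]; omega) (by simp [cone])⟩, ⟨_, Or.inl (endTriple_mem b c t),
        .of_eq 1 2 0 (by decide) (by decide) (by decide) (by simp [endTriple]; omega)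
        (by simp [endTriple])⟩, ?_, ?_, ?_⟩ <;> apply not_dvd_of_lt <;> omega
    · refine ⟨-zig b t 1, -(c - zig b t (t - 1)), ⟨_, hl, .of_eq 2 1 0 (by decide) (by decide)
        (by decide) (by simp [cone]; omega) (by simp [cone])⟩, ⟨_, Or.inl (endTriple_mem b c t),
        .of_eq 2 1 0 (by decide) (by decide) (by decide) (by simp [endTriple]; omega)
        (by simp [endTriple])⟩, ?_, ?_, ?_⟩ <;> apply not_dvd_of_lt <;> omega
  · have hr := cone_apex_mem (b := b) (c := c) (t := t) (i := i) hi0 (by omega)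
    rcases Nat.mod_two_eq_zero_or_one i with h0 | h0
    · have he := he h0
      refine ⟨-zig b t (i + 1), c - zig b t (i + 1), ⟨_, hl, .of_eq 2 1 0 (by decide) (by decide)
        (by decide) (by simp [cone]; omega) (by simp [cone])⟩, ⟨_, Or.inl hr, .of_eq 2 1 0
        (by decide) (by decide) (by decide) (by simp [cone]; omega) (by simp [cone])⟩,
        ?_, ?_, ?_⟩ <;> apply not_dvd_of_lt <;> omega
    · have ho := ho h0
      refine ⟨-zig b t i, c - zig b t i, ⟨_, hl, .of_eq 1 2 0 (by decide) (by decide)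
        (by decide) (by simp [cone]; omega) (by simp [cone])⟩, ⟨_, Or.inl hr, .of_eq 1 2 0
        (by decide) (by decide) (by decide) (by simp [cone]; omega) (by simp [cone])⟩,
        ?_, ?_, ?_⟩ <;> apply not_dvd_of_lt <;> omega

lemma twiceCovered_cones_zig {N t : ℕ} (hN : (N : ℤ) = 6 * t - 1) (ht : 2 ≤ t) {b c z : ℤ}
    (hp : Params t b c z) {i : ℕ} (hi : i < t) :
    TwiceCovered N (cones b c t) ![0, z, b] (zig b t i) := by
  have hx := zig_mem (b := b) (t := t) (i := i) (by omega)
  have hm := two_mul_zig_pred ht hp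
  unfold Params at hp
  rcases Nat.eq_zero_or_pos i with rfl | hi0
  · have h0 := zig_zero b t
    have h1 := zig_one b t
    refine ⟨zig b t 1, z, ⟨_, cone_zero_mem (i := 0) (by omega), .of_eq 0 1 2 (by decide)
      (by decide) (by decide) (by simp [cone]) (by simp [cone])⟩, ⟨_, Or.inr rfl, .of_eq 0 2 1
      (by decide) (by decide) (by decide) (by simp [h0]) (by simp)⟩, ?_, ?_, ?_⟩ <;>
      apply not_dvd_of_lt <;> omega
  · obtain ⟨j, rfl⟩ : ∃ j, i = j + 1 := ⟨i - 1, by omega⟩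
    have hy := zig_mem (b := b) (t := t) (i := j) (by omega)
    have hs := zig_step_ne (b := b) (t := t) (i := j) (by omega)
    obtain ⟨he, ho⟩ := zig_step (b := b) (t := t) (i := j)
    have hl := cone_zero_mem (b := b) (c := c) (i := j) hi
    by_cases hjt : j + 2 = t
    · have hM := endTriple_mem b c t
      unfold endTriple at hM
      rw [show t - 1 = j + 1 by omega] at hM hm
      refine ⟨c - zig b t (j + 1), zig b t j, ⟨_, hM, .of_eq 0 1 2 (by decide) (by decide)
        (by decide) (by simp) (by simp)⟩, ⟨_, Or.inl hl, .of_eq 0 2 1 (by decide) (by decide)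
        (by decide) (by simp [cone]) (by simp [cone])⟩, ?_, ?_, ?_⟩ <;>
        apply not_dvd_of_lt <;> omega
    · have hz := zig_mem (b := b) (t := t) (i := j + 2) (by push_cast; omega)
      have hzs : zig b t (j + 2) ≠ zig b t (j + 1) := (zig_step_ne (by push_cast; omega)).symm
      have hne := zig_add_two_ne (b := b) (t := t) (i := j)
      refine ⟨zig b t (j + 2), zig b t j, ⟨_, cone_zero_mem (i := j + 1) (by omega), .of_eq 0 1 2
        (by decide) (by decide) (by decide) (by simp [cone]) (by simp [cone])⟩, ⟨_, Or.inl hl,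
        .of_eq 0 2 1 (by decide) (by decide) (by decide) (by simp [cone]) (by simp [cone])⟩,
        ?_, ?_, ?_⟩ <;> apply not_dvd_of_lt <;> omega

/-- These are the spokes at the apex c. The one to vertex 1 lies in a single cone (in the end triple
if t = 2) and occurs again as the difference of z and b; the last one lies in the end triple. -/
lemma twiceCovered_cones_sub_zig {N t : ℕ} (hN : (N : ℤ) = 6 * t - 1) (ht : 2 ≤ t) {b c z : ℤ}
    (hp : Params t b c z) {i : ℕ} (hi0 : 1 ≤ i) (hi : i < t) :
    TwiceCovered N (cones b c t) ![0, z, b] (c - zig b t i) := by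
  have hx := zig_mem (b := b) (t := t) (i := i) (by omega)
  have hm := two_mul_zig_pred ht hp
  have hfirst : ∃ ζ, (∃ τ ∈ cones b c t, CoversDiff N τ (c - zig b t i) ζ) ∧
      ((i + 1 < t ∧ ζ = zig b t (i + 1) - zig b t i) ∨ (i + 1 = t ∧ ζ = zig b t i)) := by
    by_cases hit : i + 1 = t
    · refine ⟨_, ⟨_, endTriple_mem b c t, .of_eq 0 2 1 (by decide) (by decide) (by decide) ?_ rfl⟩,
        Or.inr ⟨hit, ?_⟩⟩ <;> simp [endTriple, ← hit]
    · exact ⟨_, ⟨_, cone_apex_mem hi0 (by omega), .of_eq 1 0 2 (by decide) (by decide) (by decide)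
        (by simp [cone]) rfl⟩, Or.inl ⟨by omega, by simp [cone]⟩⟩
  have hsecond : ∃ ζ, (∃ σ, (σ ∈ cones b c t ∨ σ = ![0, z, b]) ∧
      CoversDiff N σ (c - zig b t i) ζ) ∧
      ((2 ≤ i ∧ ζ = zig b t (i - 1) - zig b t i) ∨
        (i = 1 ∧ t % 2 = 1 ∧ ζ = -(2 * t)) ∨ (i = 1 ∧ t % 2 = 0 ∧ ζ = -t)) := by
    by_cases h1 : i = 1
    · subst h1
      have h1' := zig_one b t
      rcases hp with ⟨h, rfl, rfl, rfl⟩ | ⟨h, rfl, rfl, rfl⟩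
      -- Here the differences 3t - 1 and -3t agree only modulo 6t - 1.
      · exact ⟨-(2 * t), ⟨_, Or.inr rfl, 2, 1, 0, by decide, by decide, by decide,
          ⟨-1, by simp; omega⟩, ⟨0, by simp⟩⟩, Or.inr (Or.inl ⟨rfl, h, rfl⟩)⟩
      · exact ⟨-t, ⟨_, Or.inr rfl, 1, 2, 0, by decide, by decide, by decide,
          ⟨0, by simp; omega⟩, ⟨0, by simp⟩⟩, Or.inr (Or.inr ⟨rfl, h, rfl⟩)⟩
    · have hl := cone_apex_mem (b := b) (c := c) (t := t) (i := i - 1) (by omega) (by omega)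
      rw [cone, Nat.sub_add_cancel hi0] at hl
      exact ⟨_, ⟨_, Or.inl hl, .of_eq 2 0 1 (by decide) (by decide) (by decide)
        (by simp) rfl⟩, Or.inl ⟨by omega, by simp⟩⟩
  obtain ⟨ζ, hζ, hζ'⟩ := hfirst
  obtain ⟨ζ₂, hζ₂, hζ₂'⟩ := hsecond
  have hs : i = 1 → zig b t i = b - t + 1 := by rintro rfl; exact zig_one b t
  have hy := zig_mem (b := b) (t := t) (i := i - 1) (by omega)
  unfold Params at hp
  refine ⟨ζ, ζ₂, hζ, hζ₂, ?_, ?_, ?_⟩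
  all_goals
    clear hζ hζ₂
    apply not_dvd_of_lt
    rcases hζ' with ⟨hc, rfl⟩ | ⟨hc, rfl⟩
  · have h1 := zig_mem (b := b) (t := t) (i := i + 1) (by push_cast; omega)
    clear hm
    rcases hζ₂' with ⟨h2, rfl⟩ | ⟨h2, h3, rfl⟩ | ⟨h2, h3, rfl⟩
    · have h4 := zig_add_two_ne (b := b) (t := t) (i := i - 1)
      rw [show i - 1 + 2 = i + 1 by omega] at h4
      clear hp
      omega
    · omega
    · omega
  · rw [show t - 1 = i by omega] at hm
    clear hs
    rcases hζ₂' with ⟨h2, rfl⟩ | ⟨h2, h3, rfl⟩ | ⟨h2, h3, rfl⟩ <;> omega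
  · have h1 := zig_mem (b := b) (t := t) (i := i + 1) (by push_cast; omega)
    have h2 := zig_step_ne (b := b) (t := t) (i := i) (by omega)
    clear hζ₂' hp hm hs hy
    omega
  · clear hζ₂' hm hs hy
    omega
  · have h1 := zig_mem (b := b) (t := t) (i := i + 1) (by push_cast; omega)
    clear hζ₂' hm hs hy
    omega
  · rw [show t - 1 = i by omega] at hm
    clear hζ₂' hs hy
    omega

/-- Below t the steps serve. For odd t the spokes at 0 give t+1, ..., 2t and those at c give 2t+1,
..., 3t-1; for even t they give 2t, ..., 3t-1 and t+1, ..., 2t-1. Only t is left over. -/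
lemma twiceCovered_cones {N t : ℕ} (hN : (N : ℤ) = 6 * t - 1) (ht : 2 ≤ t) {b c z : ℤ}
    (hp : Params t b c z) {δ : ℤ} (h1 : 1 ≤ δ) (h2 : 2 * δ ≤ N) (h3 : δ ≠ t) :
    TwiceCovered N (cones b c t) ![0, z, b] δ := by
  by_cases h : δ < t
  · exact twiceCovered_cones_of_lt hN ht hp h1 h
  by_cases hδ : b - t < δ ∧ δ ≤ b
  · obtain ⟨i, hi, rfl⟩ := exists_zig_eq hδ.1 hδ.2
    exact twiceCovered_cones_zig hN ht hp (by omega)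
  · obtain ⟨i, hi, hx⟩ := exists_zig_eq (b := b) (t := t) (x := c - δ)
      (by unfold Params at hp; omega) (by unfold Params at hp; omega)
    -- Vertex 0 would give δ = c - b, which is 2t for odd t and t for even t, both already excluded.
    have hi0 : 1 ≤ i := by
      rcases Nat.eq_zero_or_pos i with rfl | h
      · rw [zig_zero] at hx
        unfold Params at hp
        omega
      · exact h
    rw [show δ = c - zig b t i by omega]
    exact twiceCovered_cones_sub_zig hN ht hp hi0 (by omega)

/-! ### Closed rails -/

section ClosedRail

variable {N : ℕ} {K : Type} [DecidableEq K]

lemma chainFromTo_rail_self [NeZero N] (X : K) (a s : ZMod N) :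
    ChainFromTo Share (rail N X a s N) {Sum.inr X, Sum.inl a, Sum.inl (a + s)}
      {Sum.inr X, Sum.inl (a - s), Sum.inl a} := by
  obtain ⟨m, rfl⟩ : ∃ m, N = m + 1 := ⟨N - 1, by have := NeZero.one_le (n := N); omega⟩
  have h := chainFromTo_rail X a s m
  have h0 : ((m : ZMod (m + 1))) = -1 := by
    have := ZMod.natCast_self (m + 1)
    push_cast at this
    linear_combination this
  have e1 : a + (m : ZMod (m + 1)) * s = a - s := by rw [h0]; ring
  have e2 : a + ((m + 1 : ℕ) : ZMod (m + 1)) * s = a := by rw [ZMod.natCast_self]; ring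
  rw [e1, e2] at h
  exact h

lemma exists_two_of_rail_self [NeZero N] (hN : Odd N) (h1 : N ≠ 1) (X : K) (a : ZMod N)
    {s : ZMod N} (hs : IsUnit s) {L : List (Finset (ZMod N ⊕ K))}
    (hL : ∀ B ∈ rail N X a s N, B ∈ L) (w : ZMod N) :
    ∃ B ∈ L, ∃ C ∈ L, B ≠ C ∧
      (Sum.inr X ∈ B ∧ Sum.inl w ∈ B) ∧ (Sum.inr X ∈ C ∧ Sum.inl w ∈ C) := by
  have h2 := add_self_ne_zero_of_isUnit hN h1 hs
  have hs0 : s ≠ 0 := by rintro rfl; simp at h2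
  refine ⟨_, hL _ (mem_rail X a hs w), _, hL _ (mem_rail X a hs (w - s)), fun h => ?_, by simp,
    by simp⟩
  have : Sum.inl (w + s) ∈
      ({Sum.inr X, Sum.inl (w - s), Sum.inl (w - s + s)} : Finset (ZMod N ⊕ K)) := by
    rw [← h]; simp
  simp only [Finset.mem_insert, Finset.mem_singleton, Sum.inl.injEq, reduceCtorEq, false_or,
    sub_add_cancel, add_eq_left, hs0, or_false] at this
  exact h2 (by linear_combination this)

lemma exists_of_rail_self [NeZero N] (X : K) (a : ZMod N) {s : ZMod N} (hs : IsUnit s)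
    {d : ZMod N} (hd : s = d ∨ s = -d) (w : ZMod N) :
    ∃ B ∈ rail N X a s N, Sum.inr X ∈ B ∧ Sum.inl w ∈ B ∧ Sum.inl (w + d) ∈ B := by
  rcases hd with rfl | h
  · exact ⟨_, mem_rail X a hs w, by simp, by simp, by simp⟩
  · refine ⟨_, mem_rail X a hs (w + d), by simp, ?_, by simp⟩
    rw [h]
    simp

lemma blk_add (u : ZMod N) (h : ℤ) (τ : Fin 3 → ℤ) :
    blk N K u (fun i => h + τ i) = blk N K (u + h) τ := by
  simp [blk, add_assoc]

end ClosedRail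

lemma Params.isUnit_z {N t : ℕ} (hN : (N : ℤ) = 6 * t - 1) {b c z : ℤ} (hp : Params t b c z) :
    IsUnit (z : ZMod N) := by
  rcases hp with ⟨-, -, -, rfl⟩ | ⟨-, -, -, rfl⟩
  · exact isUnit_intCast_of_dvd (-6) ⟨-1, by rw [hN]; ring⟩
  · exact isUnit_intCast_of_dvd 6 ⟨-1, by rw [hN]; ring⟩

lemma Params.z_eq {t : ℕ} {b c z : ℤ} (hp : Params t b c z) : z = t ∨ z = -t := by
  rcases hp with ⟨-, -, -, rfl⟩ | ⟨-, -, -, rfl⟩ <;> simp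

/-! ### `6 t` points -/

/-- The triples with the apex `c`, in decreasing order and translated so as to follow the triple
at the end of the zigzag. -/
def coneBack (b c : ℤ) (t j : ℕ) : Fin 3 → ℤ :=
  if j = 0 then endTriple b c t else fun i => -zig b t (t - 1) + cone b t c (t - 1 - j) i

/-- A cyclic sequence of all base triples modulo `6 t - 1`. -/
def cycle (b c z : ℤ) (t : ℕ) : List (Fin 3 → ℤ) :=
  [![0, z, b]] ++ ((List.range (t - 1)).map (cone b t 0) ++
    (List.range (t - 1)).map (coneBack b c t))

/-- The fan at 0 is run forwards to the end triple. The shift by -m, with m the end of the zigzag,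
puts {0, c-m} into the first triple of the fan at c, which is then run backwards. -/
lemma chainFromTo_cycle (N : ℕ) (b c z : ℤ) {t : ℕ} (ht : 2 ≤ t) :
    ChainFromTo (ShareMod N) (cycle b c z t) ![0, z, b] (coneBack b c t (t - 2)) := by
  obtain ⟨k, rfl⟩ := Nat.exists_eq_add_of_le' ht
  have h1 : ChainFromTo (ShareMod N) _ _ _ := ChainFromTo.map_range (k := k)
    (f := cone b (k + 2 : ℕ) 0) (R := ShareMod N)
    (fun i _ => ShareMod.of_eq 0 2 0 1 (by decide) (by decide) rfl rfl)
  have h2 : ChainFromTo (ShareMod N) _ _ _ := ChainFromTo.map_range (k := k)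
    (f := coneBack b c (k + 2 : ℕ)) (R := ShareMod N) (fun i hi => by
      rcases Nat.eq_zero_or_pos i with rfl | h0
      · have e : k + 2 - 1 - (0 + 1) + 1 = k + 2 - 1 := by omega
        exact ShareMod.of_eq 0 2 2 0 (by decide) (by decide)
          (by simp [coneBack, endTriple, cone])
          (by simp [coneBack, endTriple, cone]; ring)
      · have e : k + 2 - 1 - (i + 1) + 1 = k + 2 - 1 - i := by omega
        exact ShareMod.of_eq 0 1 0 2 (by decide) (by decide)
          (by simp [coneBack, cone, h0.ne'])
          (by simp only [coneBack, cone, h0.ne', Nat.succ_ne_zero, if_false, e]; rfl))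
  exact (ChainFromTo.singleton _).append (h1.append h2
    (ShareMod.of_eq 0 2 0 1 (by decide) (by decide) (by simp [coneBack, endTriple, cone])
      (by simp [coneBack, endTriple, cone])))
    (ShareMod.of_eq 0 2 0 1 (by decide) (by decide) rfl (by simp [cone, zig_zero]))

/-- The spoke from c to vertex 1 has the same difference, up to sign and modulo N, as the edge from
z to b; g moves that edge onto it. For t = 2 there is no fan at c, and the end triple takes over. -/
lemma shareMod_coneBack {N t : ℕ} (hN : (N : ℤ) = 6 * t - 1) (ht : 2 ≤ t) {b c z : ℤ}
    (hp : Params t b c z) {g : ℤ} (hg : (t % 2 = 1 ∧ g = 5 * t - zig b t (t - 1)) ∨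
      (t % 2 = 0 ∧ g = t - zig b t (t - 1))) :
    ShareMod N (coneBack b c t (t - 2)) (fun i => g + (![0, z, b] : Fin 3 → ℤ) i) := by
  have h1 := zig_one b t
  obtain rfl | h2 := ht.eq_or_lt
  · simp only [Params, Nat.mod_self, zero_ne_one, false_and, true_and, false_or] at hp hg
    obtain ⟨rfl, rfl, rfl⟩ := hp
    subst hg
    exact ⟨0, 2, 1, 2, by decide, by decide, ⟨0, by simp [coneBack, endTriple]; norm_num at h1; omega⟩,
      ⟨0, by simp [coneBack, endTriple]; norm_num at h1; omega⟩⟩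
  · have e : t - 1 - (t - 2) = 1 := by omega
    have e' : t - 2 ≠ 0 := by omega
    simp only [coneBack, e', if_false, e, cone]
    unfold Params at hp
    rcases hg with ⟨h, rfl⟩ | ⟨h, rfl⟩
    · exact ⟨0, 1, 1, 2, by decide, by decide, ⟨0, by simp; omega⟩, ⟨1, by simp; omega⟩⟩
    · exact ⟨1, 0, 1, 2, by decide, by decide, ⟨0, by simp; omega⟩, ⟨0, by simp; omega⟩⟩

theorem hasGrayCode_six_mul {t : ℕ} (ht : 2 ≤ t) : HasGrayCode (6 * t) := by
  obtain ⟨N, hN'⟩ : ∃ N, 6 * t = N + 1 := ⟨6 * t - 1, by omega⟩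
  have hN : (N : ℤ) = 6 * t - 1 := by omega
  rw [hN']
  have : NeZero N := ⟨by omega⟩
  obtain ⟨b, c, z, hp⟩ := exists_params t
  obtain ⟨g, hg⟩ : ∃ g : ℤ, (t % 2 = 1 ∧ g = 5 * t - zig b t (t - 1)) ∨
      (t % 2 = 0 ∧ g = t - zig b t (t - 1)) := by
    rcases Nat.mod_two_eq_zero_or_one t with h | h
    · exact ⟨_, Or.inr ⟨h, rfl⟩⟩
    · exact ⟨_, Or.inl ⟨h, rfl⟩⟩
  -- Here 2g is 7t - 1 for odd t and 2 - 3t for even t.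
  have hgu : IsUnit (g : ZMod N) := by
    have hm := two_mul_zig_pred ht hp
    rcases hg with ⟨h, hg⟩ | ⟨h, hg⟩
    · exact isUnit_intCast_of_dvd 12 ⟨-7, by omega⟩
    · refine isUnit_intCast_of_dvd (8 * t) ⟨2 * t - 1, ?_⟩
      have h2 : 2 * g = 2 - 3 * t := by omega
      rw [hN]
      linear_combination -4 * t * h2
  have hzu := hp.isUnit_z hN
  have hlift := chainFromTo_lift (K := Fin 1) (chainFromTo_cycle N b c z ht)
    (shareMod_coneBack hN ht hp hg) 0 (N - 1)
  rw [show N - 1 + 1 = N by omega] at hlift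
  -- Started at z, the closed rail ends with {X, 0, z}, next to {0, z, b}.
  have hL := (chainFromTo_rail_self (0 : Fin 1) (z : ZMod N) (z : ZMod N)).append hlift
    ⟨Sum.inl 0, Sum.inl (z : ZMod N), Sum.inr 0, Sum.inl (b : ZMod N), by
      rw [sub_self, Finset.insert_comm, Finset.pair_comm (Sum.inr 0)], by
      rw [blk_eq _ _ (i := 0) (j := 1) (k := 2) (by decide) (by decide) (by decide)]
      simp⟩
  have hmem : ∀ τ ∈ cycle b c z t, ∀ u : ZMod N, blk N (Fin 1) u τ ∈
      rail N (0 : Fin 1) (z : ZMod N) z N ++ lift N (Fin 1) (cycle b c z t) g 0 N := by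
    intro τ hτ u
    obtain ⟨j, hj, rfl⟩ := exists_eq_mul_of_isUnit hgu u
    exact List.mem_append_right _ (mem_lift (Nat.zero_le _) (by omega) hτ)
  have hρ : ![0, z, b] ∈ cycle b c z t := List.mem_cons_self
  have hback : ∀ j < t - 1, coneBack b c t j ∈ cycle b c z t := fun j hj =>
    List.mem_append_right _ (List.mem_append_right _
      (List.mem_map.2 ⟨j, List.mem_range.2 hj, rfl⟩))
  refine ChainFromTo.hasGrayCode (N := N) (c := 1) hL ?_ ?_ ?_ ?_ ?_
  · intro B hB
    rcases List.mem_append.1 hB with hB | hB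
    · exact card_le_of_mem_rail hB
    · exact card_le_of_mem_lift hB
  · simp only [List.length_append, length_rail, length_lift, cycle, List.length_singleton,
      List.length_map, List.length_range]
    rw [← hN', show 6 * t - 1 = N by omega]
    obtain ⟨k, rfl⟩ := Nat.exists_eq_add_of_le' ht
    rw [show k + 2 - 1 = k + 1 by omega]
    ring
  · intro a b' hab
    refine exists_two_of_forall_diff (fun δ h1 h2 a => ?_) hab
    by_cases hδ : δ = t
    · obtain ⟨B, hB, hBX, hB1, hB2⟩ := exists_of_rail_self (0 : Fin 1) (z : ZMod N) hzu
        (d := (δ : ZMod N)) (by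
          rw [hδ]; rcases hp.z_eq with h | h <;> simp [h]) a
      obtain ⟨u, hu⟩ : ∃ u : ZMod N, Sum.inl a ∈ blk N (Fin 1) u ![0, z, b] ∧
          Sum.inl (a + (δ : ZMod N)) ∈ blk N (Fin 1) u ![0, z, b] := by
        rw [hδ]
        rcases hp.z_eq with h | h
        · exact ⟨a, by simpa using mem_blk (K := Fin 1) a ![0, z, b] 0,
            by simpa [h] using mem_blk (K := Fin 1) a ![0, z, b] 1⟩
        · exact ⟨a + t, by simpa [h] using mem_blk (K := Fin 1) (a + (t : ZMod N)) ![0, z, b] 1,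
            by simpa using mem_blk (K := Fin 1) (a + (t : ZMod N)) ![0, z, b] 0⟩
      exact ⟨B, List.mem_append_left _ hB, _, hmem _ hρ u,
        fun h => inr_notMem_blk u _ 0 (h ▸ hBX), ⟨hB1, hB2⟩, hu⟩
    · refine exists_two_of_twiceCovered (fun τ hτ u => ?_)
        (fun u i j _ => ⟨_, hmem _ hρ u, mem_blk _ _ _, mem_blk _ _ _, Or.inl rfl⟩)
        (twiceCovered_cones hN ht hp h1 h2 hδ) a
      rcases mem_cones_cases hτ with rfl | ⟨i, hi, rfl⟩ | ⟨i, h0, hi, rfl⟩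
      · exact hmem _ (by simpa [coneBack] using hback 0 (by omega)) u
      · exact hmem _ (List.mem_append_right _ (List.mem_append_left _
          (List.mem_map.2 ⟨i, List.mem_range.2 (by omega), rfl⟩))) u
      -- The triple stands in the cycle shifted by -m, so the translation by u + m restores it.
      · have := hmem _ (hback (t - 1 - i) (by omega)) (u + (zig b t (t - 1) : ℤ))
        rw [coneBack, if_neg (by omega), blk_add, show t - 1 - (t - 1 - i) = i by omega] at this
        simpa using this
  · intro X w
    rw [Subsingleton.elim X 0]
    exact exists_two_of_rail_self ⟨3 * t - 1, by omega⟩ (by omega) 0 _ hzu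
      (fun B hB => List.mem_append_left _ hB) w
  · exact fun X Y h => absurd (Subsingleton.elim X Y) h

/-! ### `6 t + 3` points -/

/-- The apex of the last triple in the `i`-th step of the ladder. -/
def apex (c : ℤ) (i : ℕ) : ℤ := if i % 2 = 0 then 0 else c

/-- The triples over the `i`-th edge of the zigzag, in the order in which they are passed. -/
def rung (b c : ℤ) (t i : ℕ) : List (Fin 3 → ℤ) :=
  if i = 0 then [cone b t 0 0] else [cone b t (apex c (i - 1)) i, cone b t (apex c i) i]

/-- The translation of the end triple in the ladder. -/
def endShift (b : ℤ) (t : ℕ) : ℤ := if t % 2 = 0 then 0 else zig b t (t - 1)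

/-- A cyclic sequence of the base triples modulo `6 t - 1` other than `{0, z, b}`. -/
def ladder (b c : ℤ) (t : ℕ) : List (Fin 3 → ℤ) :=
  (List.range (t - 1)).flatMap (rung b c t) ++ [fun i => endShift b t + endTriple b c t i]

lemma length_flatMap_rung (b c : ℤ) (t k : ℕ) :
    ((List.range (k + 1)).flatMap (rung b c t)).length = 2 * k + 1 := by
  induction k with
  | zero => simp [rung]
  | succ k ih =>
    rw [List.range_succ, List.flatMap_append, List.length_append, ih]
    simp [rung]
    ring

/-- Each rung changes the apex over one edge, and passing to the next edge keeps the apex. The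
parity of t decides the last apex, and `endShift` moves the end triple so that it contains this apex
and the last vertex. -/
lemma chainFromTo_ladder (N : ℕ) (b c : ℤ) {t : ℕ} (ht : 2 ≤ t) :
    ChainFromTo (ShareMod N) (ladder b c t) (cone b t 0 0)
      (fun i => endShift b t + endTriple b c t i) := by
  obtain ⟨k, rfl⟩ := Nat.exists_eq_add_of_le' ht
  have h := ChainFromTo.flatMap_range (R := ShareMod N) (F := rung b c (k + 2))
    (s := fun i => cone b (k + 2 : ℕ) (if i = 0 then 0 else apex c (i - 1)) i)
    (e := fun i => cone b (k + 2 : ℕ) (apex c i) i) (k := k) (fun i _ => by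
      unfold rung
      split_ifs with h
      · subst h
        exact ChainFromTo.singleton _
      · exact (ChainFromTo.singleton _).cons
          (.of_eq 1 2 1 2 (by decide) (by decide) rfl rfl))
    (fun i _ => .of_eq 0 2 0 1 (by decide) (by decide) (by simp [cone]) rfl)
  refine h.append (.singleton _) ?_
  rcases Nat.mod_two_eq_zero_or_one k with hk | hk
  · exact .of_eq 0 2 0 1 (by decide) (by decide)
      (by simp [cone, apex, endShift, endTriple, hk]) (by simp [cone, endShift, endTriple, hk])
  · exact .of_eq 0 2 2 0 (by decide) (by decide)
      (by simp [cone, apex, endShift, endTriple, hk]) (by simp [cone, endShift, endTriple, hk])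

/-- The closing pair is the edge of length t-1: {m, c-m} in the end triple and the first zigzag edge
in the first cone. Thus {0, z, b} is not needed to close the cycle. -/
lemma shareMod_ladder {N t : ℕ} (ht : 2 ≤ t) {b c z : ℤ} (hp : Params t b c z) {g : ℤ}
    (hg : (t % 2 = 1 ∧ g = 2 * t) ∨ (t % 2 = 0 ∧ 2 * g = -t)) :
    ShareMod N (fun i => endShift b t + endTriple b c t i) (fun i => g + cone b t 0 0 i) := by
  have hm := two_mul_zig_pred ht hp
  have h0 := zig_zero b t
  have h1 := zig_one b t
  unfold Params at hp
  rcases hg with ⟨h, hg⟩ | ⟨h, hg⟩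
  · exact .of_eq 1 2 2 1 (by decide) (by decide)
      (by simp [cone, endShift, endTriple, h]; omega)
      (by simp [cone, endShift, endTriple, h]; omega)
  · exact .of_eq 1 2 1 2 (by decide) (by decide)
      (by simp [cone, endShift, endTriple, h]; omega)
      (by simp [cone, endShift, endTriple, h]; omega)

lemma exists_add_mem_ladder {b c : ℤ} {t : ℕ} {τ : Fin 3 → ℤ} (hτ : τ ∈ cones b c t) :
    ∃ h : ℤ, (fun i => h + τ i) ∈ ladder b c t := by
  rcases mem_cones_cases hτ with rfl | ⟨i, hi, rfl⟩ | ⟨i, h0, hi, rfl⟩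
  · exact ⟨_, List.mem_append_right _ (List.mem_singleton_self _)⟩
  · refine ⟨0, List.mem_append_left _ (List.mem_flatMap.2 ⟨i, List.mem_range.2 (by omega), ?_⟩)⟩
    simp only [zero_add]
    unfold rung apex
    split_ifs <;> first | omega | simp_all
  · refine ⟨0, List.mem_append_left _ (List.mem_flatMap.2 ⟨i, List.mem_range.2 (by omega), ?_⟩)⟩
    simp only [zero_add]
    unfold rung apex
    split_ifs <;> first | omega | simp_all

lemma inr_notMem_of_mem_ring {N : ℕ} {K : Type} [DecidableEq K] {A B C X : K} {u : ZMod N}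
    {ρ : Fin 3 → ℤ} {D : Finset (ZMod N ⊕ K)} (hD : D ∈ ring A B C u ρ) (hA : X ≠ A) (hB : X ≠ B)
    (hC : X ≠ C) : Sum.inr X ∉ D := by
  have hr : ∀ {Y : K} {a s : ZMod N} {m : ℕ}, X ≠ Y → D ∈ rail N Y a s m → Sum.inr X ∉ D := by
    intro Y a s m hY h
    obtain ⟨j, -, rfl⟩ := List.mem_map.1 h
    simp [hY]
  rcases mem_ring_iff.1 hD with rfl | h | rfl | h | rfl | h
  · simp [hA, hB]
  · exact hr hB h
  · simp [hB, hC]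
  · exact hr hC h
  · simp [hA, hC]
  · exact hr hA h

/-- The triples of outer points in the construction with four outer points. -/
def remnants : List (Finset (Fin 4)) := [{3, 2, 1}, {0, 3, 2}, {0, 1, 3}]

/-- Outer points 0, 1, 2 carry a ring that replaces the translates of {0, z, b}; point 3 carries a
closed rail for the second occurrence of t. The three triples in `remnants` complete the outer
pairs: once inside {0, 1, 2}, twice with 3. -/
theorem hasGrayCode_six_mul_add_three {t : ℕ} (ht : 2 ≤ t) : HasGrayCode (6 * t + 3) := by
  obtain ⟨N, hN'⟩ : ∃ N, 6 * t = N + 1 := ⟨6 * t - 1, by omega⟩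
  have hN : (N : ℤ) = 6 * t - 1 := by omega
  rw [show 6 * t + 3 = N + 4 by omega]
  have : NeZero N := ⟨by omega⟩
  obtain ⟨b, c, z, hp⟩ := exists_params t
  obtain ⟨g, hg⟩ : ∃ g : ℤ, (t % 2 = 1 ∧ g = 2 * t) ∨ (t % 2 = 0 ∧ 2 * g = -t) := by
    rcases Nat.mod_two_eq_zero_or_one t with h | h
    · exact ⟨-(t / 2), Or.inr ⟨h, by omega⟩⟩
    · exact ⟨_, Or.inl ⟨h, rfl⟩⟩
  have hgu : IsUnit (g : ZMod N) := by
    rcases hg with ⟨h, hg⟩ | ⟨h, hg⟩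
    · exact isUnit_intCast_of_dvd 3 ⟨-1, by omega⟩
    · exact isUnit_intCast_of_dvd (-12) ⟨-1, by omega⟩
  have hzu := hp.isUnit_z hN
  have h10 : IsUnit (((![0, z, b] : Fin 3 → ℤ) 1 - (![0, z, b] : Fin 3 → ℤ) 0 : ℤ) : ZMod N) := by
    simpa using hzu
  have h02 : IsUnit (((![0, z, b] : Fin 3 → ℤ) 0 - (![0, z, b] : Fin 3 → ℤ) 2 : ℤ) : ZMod N) := by
    rcases hp with ⟨-, rfl, -, -⟩ | ⟨-, rfl, -, -⟩
    · exact isUnit_intCast_of_dvd (-3) ⟨-1, by simp; omega⟩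
    · exact isUnit_intCast_of_dvd 2 ⟨1, by simp; omega⟩
  have h21 : IsUnit (((![0, z, b] : Fin 3 → ℤ) 2 - (![0, z, b] : Fin 3 → ℤ) 1 : ℤ) : ZMod N) := by
    rcases hp with ⟨-, rfl, -, rfl⟩ | ⟨-, rfl, -, rfl⟩
    · exact isUnit_intCast_of_dvd 2 ⟨-1, by simp; omega⟩
    · exact isUnit_intCast_of_dvd (-9 * t) ⟨3 * t - 1, by rw [hN]; simp; ring⟩
  have hlift := chainFromTo_lift (K := Fin 4) (chainFromTo_ladder N b c ht)
    (shareMod_ladder ht hp hg) 0 (N - 1)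
  rw [show N - 1 + 1 = N by omega] at hlift
  have hring := chainFromTo_ring (N := N) (by omega) (0 : Fin 4) 1 2 0 ![0, z, b]
  have hrail := chainFromTo_rail_self (3 : Fin 4) (0 : ZMod N) (-(z : ZMod N))
  have hT := (ChainFromTo.singleton (R := Share) (blk N (Fin 4) 0 ![0, z, b])).append hlift (by
    rw [Nat.cast_zero, zero_mul]
    have h : ShareMod N ![0, z, b] (cone b t 0 0) :=
      .of_eq 0 2 0 1 (by decide) (by decide) rfl (by simp [cone, zig_zero])
    exact share_blk h 0)
  have hO := hring.append (hrail.append hT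
    ⟨Sum.inl (z : ZMod N), Sum.inl 0, Sum.inr 3, Sum.inl (b : ZMod N), by
      rw [Finset.insert_comm, Finset.pair_comm (Sum.inr 3), sub_neg_eq_add, zero_add], by
      rw [blk_eq _ _ (i := 1) (j := 0) (k := 2) (by decide) (by decide) (by decide)]
      -- The ring ends on the edge {0, -z}, where the rail of point 3 starts; that rail ends on {z,
      -- 0}, an edge of the kept triple.
      simp⟩)
    ⟨Sum.inl 0, Sum.inl (-(z : ZMod N)), Sum.inr 0, Sum.inr 3, by
      rw [Finset.insert_comm, Finset.pair_comm (Sum.inr 0)]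
      simp, by
      rw [Finset.insert_comm, Finset.pair_comm (Sum.inr 3), zero_add]⟩
  have hL := ((hO.cons (c := {Sum.inr 0, Sum.inr 1, Sum.inr 3})
      ⟨Sum.inr 0, Sum.inr 1, Sum.inr 3, _, rfl, rfl⟩).cons (c := {Sum.inr 0, Sum.inr 3, Sum.inr 2})
      ⟨Sum.inr 0, Sum.inr 3, Sum.inr 2, Sum.inr 1, rfl, by
        rw [Finset.pair_comm (Sum.inr 3)]⟩).cons (c := {Sum.inr 3, Sum.inr 2, Sum.inr 1})
      ⟨Sum.inr 3, Sum.inr 2, Sum.inr 1, Sum.inr 0, rfl, by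
        rw [Finset.insert_comm, Finset.pair_comm (Sum.inr 0)]⟩
  set L : List (Finset (ZMod N ⊕ Fin 4)) := _ :: _ with hLdef
  have hring : ∀ D ∈ ring (0 : Fin 4) 1 2 0 ![0, z, b], D ∈ L := by
    intro D hD
    simp only [hLdef, List.mem_cons, List.mem_append]
    tauto
  have hrail : ∀ D ∈ rail N (3 : Fin 4) 0 (-(z : ZMod N)) N, D ∈ L := by
    intro D hD
    simp only [hLdef, List.mem_cons, List.mem_append]
    tauto
  have hρ : blk N (Fin 4) 0 ![0, z, b] ∈ L := by simp [hLdef]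
  have hT : ∀ τ ∈ cones b c t, ∀ u : ZMod N, blk N (Fin 4) u τ ∈ L := by
    intro τ hτ u
    obtain ⟨h, hh⟩ := exists_add_mem_ladder hτ
    obtain ⟨j, hj, hu⟩ := exists_eq_mul_of_isUnit hgu (u - h)
    have := mem_lift (N := N) (K := Fin 4) (g := g) (Nat.zero_le j)
      (show j < 0 + N by omega) hh
    rw [← hu, blk_add, sub_add_cancel] at this
    simp only [hLdef, List.mem_cons, List.mem_append]
    tauto
  have hrem : ∀ S ∈ remnants, S.image Sum.inr ∈ L := by
    simp [hLdef, remnants]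
  refine ChainFromTo.hasGrayCode (N := N) (c := 4) hL ?_ ?_ ?_ ?_ ?_
  · intro B hB
    simp only [hLdef, List.mem_cons, List.mem_append, List.not_mem_nil, or_false] at hB
    rcases hB with rfl | rfl | rfl | hB | hB | rfl | hB
    · exact Finset.card_le_three
    · exact Finset.card_le_three
    · exact Finset.card_le_three
    · exact card_le_of_mem_ring hB
    · exact card_le_of_mem_rail hB
    · exact card_blk_le _ _
    · exact card_le_of_mem_lift hB
  · obtain ⟨k, rfl⟩ := Nat.exists_eq_add_of_le' ht
    simp only [hLdef, List.length_cons, List.length_append, length_lift, length_ring, length_rail, ladder,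
      List.length_nil, show k + 2 - 1 = k + 1 by omega, length_flatMap_rung]
    obtain rfl : N = 6 * k + 11 := by omega
    rw [show 6 * k + 11 + 4 - 1 = 6 * k + 14 by omega]
    ring
  · intro x y hxy
    refine exists_two_of_forall_diff (fun δ h1 h2 a => ?_) hxy
    by_cases hδ : δ = t
    · obtain ⟨B, hB, hBX, hB1, hB2⟩ := exists_of_rail_self (3 : Fin 4) (0 : ZMod N) hzu.neg
        (d := (δ : ZMod N)) (by
          rw [hδ]; rcases hp.z_eq with h | h <;> simp [h]) a
      obtain ⟨u, i, j, hij, hi, hj⟩ : ∃ (u : ZMod N) (i j : Fin 3), i ≠ j ∧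
          u + ((![0, z, b] : Fin 3 → ℤ) i : ℤ) = a ∧
          u + ((![0, z, b] : Fin 3 → ℤ) j : ℤ) = a + (δ : ZMod N) := by
        rw [hδ]
        rcases hp.z_eq with h | h
        · exact ⟨a, 0, 1, by decide, by simp, by simp [h]⟩
        · exact ⟨a + (t : ZMod N), 1, 0, by decide, by simp [h], by simp⟩
      -- Searching only the ring and the kept triple yields a block without the outer point 3, hence
      -- different from `B`.
      obtain ⟨D, hD, hD1, hD2, -⟩ := exists_of_ring (K := Fin 4)
        (L := ring 0 1 2 0 ![0, z, b] ++ [blk N (Fin 4) 0 ![0, z, b]]) h02 h21 h10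
        (fun D hD => List.mem_append_left _ hD)
        (List.mem_append_right _ (List.mem_singleton_self _)) u i j hij
      rw [hi] at hD1
      rw [hj] at hD2
      refine ⟨B, hrail B hB, D, ?_, ?_, ⟨hB1, hB2⟩, hD1, hD2⟩
      · rcases List.mem_append.1 hD with hD | hD
        · exact hring D hD
        · rw [List.mem_singleton.1 hD]
          exact hρ
      · rintro rfl
        rcases List.mem_append.1 hD with hD | hD
        · exact inr_notMem_of_mem_ring hD (by decide) (by decide) (by decide) hBX
        · rw [List.mem_singleton.1 hD] at hBX
          exact inr_notMem_blk _ _ _ hBX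
    · exact exists_two_of_twiceCovered hT
        (fun u i j hij => exists_of_ring h02 h21 h10 hring hρ u i j hij)
        (twiceCovered_cones hN ht hp h1 h2 hδ) a
  · intro X w
    by_cases hX : X = 3
    · subst hX
      exact exists_two_of_rail_self ⟨3 * t - 1, by omega⟩ (by omega) 3 0 hzu.neg hrail w
    · refine exists_two_of_ring ⟨3 * t - 1, by omega⟩ (by omega) h02 h21 h10 (A := 0) (B := 1)
        (C := 2) hring (by decide) (by decide) (by decide) ?_ w
      revert X
      decide
  · have key : ∀ X Y : Fin 4, X ≠ Y →
        ((X = 0 ∨ X = 1 ∨ X = 2) ∧ (Y = 0 ∨ Y = 1 ∨ Y = 2) ∧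
          ∃ S ∈ remnants, X ∈ S ∧ Y ∈ S) ∨
        ∃ S ∈ remnants, ∃ S' ∈ remnants, S ≠ S' ∧ (X ∈ S ∧ Y ∈ S) ∧ (X ∈ S' ∧ Y ∈ S') := by
      decide
    intro X Y hXY
    have hm : ∀ {S : Finset (Fin 4)} {X : Fin 4}, X ∈ S →
        Sum.inr X ∈ S.image (Sum.inr : Fin 4 → ZMod N ⊕ Fin 4) :=
      fun h => Finset.mem_image_of_mem _ h
    rcases key X Y hXY with ⟨hX, hY, S, hS, h1, h2⟩ | ⟨S, hS, S', hS', hne, h1, h2⟩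
    · exact exists_two_of_corner hring hX hY hXY (hrem S hS) (by simp) (hm h1) (hm h2)
    · exact ⟨_, hrem S hS, _, hrem S' hS',
        fun h => hne (Finset.image_injective Sum.inr_injective h),
        ⟨hm h1.1, hm h1.2⟩, hm h2.1, hm h2.2⟩

/-! ### Small numbers of points -/

lemma share_of_card_inter {V : Type*} [DecidableEq V] {B C : Finset V} (hB : B.card = 3)
    (hC : C.card = 3) (h : (B ∩ C).card = 2) : Share B C := by
  obtain ⟨a, b, -, hab⟩ := Finset.card_eq_two.1 h
  have key : ∀ D : Finset V, D.card = 3 → B ∩ C ⊆ D → ∃ c, D = {a, b, c} := by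
    intro D hD hs
    obtain ⟨c, hc⟩ := Finset.card_eq_one.1
      (show (D \ (B ∩ C)).card = 1 by rw [Finset.card_sdiff_of_subset hs]; omega)
    refine ⟨c, ?_⟩
    rw [← Finset.sdiff_union_of_subset hs, hc, hab]
    ext x
    simp only [Finset.mem_union, Finset.mem_singleton, Finset.mem_insert]
    tauto
  obtain ⟨c, hc⟩ := key B hB Finset.inter_subset_left
  obtain ⟨d, hd⟩ := key C hC Finset.inter_subset_right
  exact ⟨a, b, c, d, hc, hd⟩

/-- For t ≤ 1 the zigzag has no edge, so the small orders need explicit lists. On `Fin n` all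
hypotheses are decidable. -/
lemma hasGrayCode_of_list {n : ℕ} (L : List (Finset (Fin n))) (hne : L ≠ [])
    (hcard : ∀ B ∈ L, B.card = 3) (hlen : 3 * L.length = n * (n - 1))
    (hcov : ∀ x y : Fin n, x ≠ y →
      ∃ B ∈ L, (x ∈ B ∧ y ∈ B) ∧ ∃ C ∈ L, (x ∈ C ∧ y ∈ C) ∧ B ≠ C)
    (hch : L.IsChain fun B C => (B ∩ C).card = 2) : HasGrayCode n := by
  obtain ⟨T, hT⟩ := exists_grayCode_of_list L hne (fun B hB => (hcard B hB).le)
    (by simpa using hlen.le) (fun x y hxy => by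
      obtain ⟨B, hB, h1, C, hC, h2, h⟩ := hcov x y hxy
      exact ⟨B, hB, C, hC, h, h1, h2⟩)
    (hch.imp_of_mem_imp fun B C hB hC h => share_of_card_inter (hcard B hB) (hcard C hC) h)
  exact ⟨_, inferInstance, inferInstance, T, Fintype.card_fin n, hT⟩

theorem hasGrayCode_four : HasGrayCode 4 :=
  hasGrayCode_of_list
    [{0, 1, 2}, {1, 2, 3}, {0, 1, 3}, {0, 2, 3}]
    (by decide) (by decide +kernel) rfl (by decide +kernel) (by decide +kernel)

theorem hasGrayCode_six : HasGrayCode 6 :=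
  hasGrayCode_of_list
    [{0, 1, 2}, {1, 2, 3}, {1, 3, 5}, {0, 3, 5}, {0, 2, 5}, {2, 4, 5}, {1, 4, 5}, {0, 1, 4},
     {0, 3, 4}, {2, 3, 4}]
    (by decide) (by decide +kernel) rfl (by decide +kernel) (by decide +kernel)

theorem hasGrayCode_seven : HasGrayCode 7 :=
  hasGrayCode_of_list
    [{0, 1, 2}, {1, 2, 4}, {2, 4, 6}, {0, 4, 6}, {0, 3, 4}, {3, 4, 5}, {1, 4, 5}, {1, 5, 6},
     {0, 5, 6}, {0, 2, 5}, {2, 3, 5}, {2, 3, 6}, {1, 3, 6}, {0, 1, 3}]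
    (by decide) (by decide +kernel) rfl (by decide +kernel) (by decide +kernel)

theorem hasGrayCode_nine : HasGrayCode 9 :=
  hasGrayCode_of_list
    [{0, 1, 2}, {0, 1, 6}, {1, 6, 7}, {1, 5, 7}, {1, 3, 5}, {1, 3, 4}, {3, 4, 6}, {3, 6, 8},
     {3, 7, 8}, {0, 7, 8}, {0, 4, 8}, {0, 4, 7}, {4, 5, 7}, {2, 4, 5}, {2, 4, 6}, {2, 6, 7},
     {2, 3, 7}, {0, 2, 3}, {0, 3, 5}, {0, 5, 6}, {5, 6, 8}, {2, 5, 8}, {1, 2, 8}, {1, 4, 8}]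
    (by decide) (by decide +kernel) rfl (by decide +kernel) (by decide +kernel)

theorem hasGrayCode_ten : HasGrayCode 10 :=
  hasGrayCode_of_list
    [{0, 1, 2}, {0, 2, 8}, {2, 5, 8}, {5, 8, 9}, {5, 7, 9}, {1, 7, 9}, {1, 2, 7}, {2, 3, 7},
     {3, 6, 7}, {5, 6, 7}, {2, 5, 6}, {2, 4, 6}, {1, 4, 6}, {1, 6, 8}, {6, 8, 9}, {0, 6, 9},
     {0, 3, 6}, {0, 3, 5}, {0, 1, 5}, {1, 4, 5}, {3, 4, 5}, {3, 4, 8}, {1, 3, 8}, {1, 3, 9},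
     {2, 3, 9}, {2, 4, 9}, {0, 4, 9}, {0, 4, 7}, {4, 7, 8}, {0, 7, 8}]
    (by decide) (by decide +kernel) rfl (by decide +kernel) (by decide +kernel)

/-! ### The equivalence -/

theorem hasGrayCode_of_modEq {v : ℕ} (hv : 4 ≤ v) (h : v % 3 = 0 ∨ v % 3 = 1) : HasGrayCode v := by
  obtain ⟨t, rfl | rfl | rfl | rfl⟩ :
      ∃ t, v = 6 * t ∨ v = 6 * t + 1 ∨ v = 6 * t + 3 ∨ v = 6 * t + 4 := ⟨v / 6, by omega⟩
  · obtain rfl | ht : t = 1 ∨ 2 ≤ t := by omega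
    · exact hasGrayCode_six
    · exact hasGrayCode_six_mul ht
  · obtain rfl | ht : t = 1 ∨ 2 ≤ t := by omega
    · exact hasGrayCode_seven
    · exact hasGrayCode_six_mul_add_one ht
  · obtain rfl | ht : t = 1 ∨ 2 ≤ t := by omega
    · exact hasGrayCode_nine
    · exact hasGrayCode_six_mul_add_three ht
  · obtain rfl | rfl | ht : t = 0 ∨ t = 1 ∨ 2 ≤ t := by omega
    · exact hasGrayCode_four
    · exact hasGrayCode_ten
    · exact hasGrayCode_six_mul_add_four ht

theorem theorem8p2 (v : ℕ) (hv : 3 ≤ v) :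
    (∃ (V : Type) (_ : Fintype V) (_ : DecidableEq V) (T : TwofoldTripleSystem V),
      Fintype.card V = v ∧ HasHamiltonPath (T.blockIntersectionGraph 2)) ↔
    (v ≡ 0 [MOD 3] ∨ v ≡ 1 [MOD 3]) ∧ v ≠ 3 := by
  constructor
  · rintro ⟨V, _, _, T, rfl, hT⟩
    exact ⟨modEq_of_twofoldTripleSystem T (by omega), card_ne_three_of_hasHamiltonPath T hT⟩
  · rintro ⟨h, h3⟩
    exact hasGrayCode_of_modEq (by omega) h
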